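/- **Setting.** For $\alpha\in\mathbb R$ let $$\mu^{\rm osc}(\alpha)=\inf\Big\{\int_0^\infty \big(|u'|^2+(t+\alpha)^2u^2\big)\,dt \;:\; u\in H^1(0,\infty),\ (t+\alpha)u\in L^2(0,\infty),\ \int_0^\infty u^2\,dt=1\Big\}$$ be the ground state energy of $-\partial_t^2+(t+\alpha)^2$ on $L^2(\mathbb R^+)$ with Neumann condition at $0$, and $\Theta_0=\inf_{\alpha\in\mathbb R}\mu^{\rm osc}(\alpha)$. For $b,k,c_0>0$ and $0<\varepsilon<1$, let $t_\varepsilon=c_0|\log\varepsilon|$ (with $\varepsilon$ so small that $\varepsilon k t_\varepsilon<1$), $I_\varepsilon=[0,t_\varepsilon]$, and, for $\alpha\in\mathbb R$ and real-valued $f\in H^1(I_\varepsilon)$ (identified with its continuous representative), $$\mathcal E_{k,\alpha}[f]=\int_0^{t_\varepsilon}(1-\varepsilon kt)\Big\{|f'|^2+\frac{(t+\alpha-\frac12\varepsilon kt^2)^2}{(1-\varepsilon kt)^2}f^2-\frac1{2b}\big(2f^2-f^4\big)\Big\}\,dt,\qquad E_{k,\alpha}=\inf_{f\in H^1(I_\varepsilon)}\mathcal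 E_{k,\alpha}[f].$$ Let $\alpha_k$ denote any minimizer of $\alpha\mapsto E_{k,\alpha}$ over $\mathbb R$, and $f_k\ge 0$ a non-negative minimizer of $\mathcal E_{k,\alpha_k}$ over $H^1(I_\varepsilon)$. Set $$F_k(t)=2\int_0^t(1-\varepsilon k\eta)\,f_k^2(\eta)\,\frac{\eta+\alpha_k-\frac12\varepsilon k\eta^2}{(1-\varepsilon k\eta)^2}\,d\eta,\qquad K_k(t)=(1-d_\varepsilon)f_k^2(t)+F_k(t),$$ $$\bar I_{k,\varepsilon}=\{t\in I_\varepsilon:\ f_k(t)\ge|\log\varepsilon|^3f_k(t_\varepsilon)\}.$$ **Proposition 3.2.** Let $1<b<\Theta_0^{-1}$, $k>0$, $c_0>0$ and $C>0$. There is $\varepsilon_0>0$ (depending only on $b,k,c_0,C$) such that for all $0<\varepsilon<\varepsilon_0$, all $d_\varepsilon$ with $0<d_\varepsilon\le C|\log\varepsilon|^{-4}$, and every such $\alpha_k$ and $f_k$, $$K_k(t)\ge 0\qquad\text{for every } t\in\bar I_{k,\varepsilon}.$$ -/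

import Mathlib

noncomputable section

open MeasureTheory Set

namespace SurfaceSC

/-- The real Sobolev space `H¹(0, T)`, each class being given by its continuous representative
on `[0, T]`: absolutely continuous functions with square integrable derivative. Only the values
of `f` on `[0, T]` matter (the derivative at the two end points is irrelevant). -/
def MemH1 (T : ℝ) (f : ℝ → ℝ) : Prop :=
  AbsolutelyContinuousOnInterval f 0 T ∧ MemLp (deriv f) 2 (volume.restrict (Icc 0 T))

/-- Form domain of the half-line operator `-∂ₜ² + (t + α)²` with Neumann condition at `0`:
`u ∈ H¹(0, ∞)` (continuous representative) with `(t + α) u ∈ L²(0, ∞)`. -/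
def MemOscDomain (α : ℝ) (u : ℝ → ℝ) : Prop :=
  (∀ R : ℝ, 0 < R → AbsolutelyContinuousOnInterval u 0 R) ∧
  MemLp u 2 (volume.restrict (Ioi 0)) ∧
  MemLp (deriv u) 2 (volume.restrict (Ioi 0)) ∧
  MemLp (fun t => (t + α) * u t) 2 (volume.restrict (Ioi 0))

/-- Ground state energy `μ^osc(α)` of `-∂ₜ² + (t + α)²` on `L²(0, ∞)` with Neumann condition at
`0`: the infimum of the quadratic form over normalized functions of the form domain. -/
def muOsc (α : ℝ) : ℝ :=
  sInf {E : ℝ | ∃ u : ℝ → ℝ, MemOscDomain α u ∧ ∫ t in Ioi (0 : ℝ), u t ^ 2 = 1 ∧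
    E = ∫ t in Ioi (0 : ℝ), (deriv u t ^ 2 + (t + α) ^ 2 * u t ^ 2)}

/-- The constant `Θ₀ = inf_α μ^osc(α)`. -/
def Theta0 : ℝ := ⨅ α : ℝ, muOsc α

/-- The length `t_ε = c₀ |log ε|` of the interval `I_ε = [0, t_ε]`. -/
def tEps (c₀ ε : ℝ) : ℝ := c₀ * |Real.log ε|

/-- The one-dimensional energy functional with curvature `k` and phase `α`. -/
def energy (b k c₀ ε α : ℝ) (f : ℝ → ℝ) : ℝ :=
  ∫ t in (0 : ℝ)..tEps c₀ ε, (1 - ε * k * t) *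
    (deriv f t ^ 2
      + (t + α - 1 / 2 * ε * k * t ^ 2) ^ 2 / (1 - ε * k * t) ^ 2 * f t ^ 2
      - 1 / (2 * b) * (2 * f t ^ 2 - f t ^ 4))

/-- The ground state energy `E_{k,α} = inf { energy of f | f ∈ H¹(I_ε) }`. -/
def groundEnergy (b k c₀ ε α : ℝ) : ℝ :=
  sInf (energy b k c₀ ε α '' {f | MemH1 (tEps c₀ ε) f})

/-- `α` is an optimal phase `α_k` and `f` is the associated profile `f_k`:
`α` minimizes the ground state energy among all real phases, and `f` is a non-negative minimizer
of the functional with phase `α` over `H¹(I_ε)`. -/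
structure IsOptimal (b k c₀ ε α : ℝ) (f : ℝ → ℝ) : Prop where
  memH1 : MemH1 (tEps c₀ ε) f
  nonneg : ∀ t ∈ Icc 0 (tEps c₀ ε), 0 ≤ f t
  isMinOn_profile : IsMinOn (energy b k c₀ ε α) {g | MemH1 (tEps c₀ ε) g} f
  isMinOn_phase : IsMinOn (groundEnergy b k c₀ ε) univ α

/-- The potential function `F_k` attached to the phase `α` and the profile `f`. -/
def potentialF (k ε α : ℝ) (f : ℝ → ℝ) (t : ℝ) : ℝ :=
  2 * ∫ η in (0 : ℝ)..t, (1 - ε * k * η) * f η ^ 2 *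
    ((η + α - 1 / 2 * ε * k * η ^ 2) / (1 - ε * k * η) ^ 2)

/-- The cost function `K_k = (1 - d) f² + F_k`. -/
def costK (k ε d α : ℝ) (f : ℝ → ℝ) (t : ℝ) : ℝ :=
  (1 - d) * f t ^ 2 + potentialF k ε α f t

/-- The region `{t ∈ I_ε | f(t) ≥ |log ε|³ f(t_ε)}`. -/
def region (c₀ ε : ℝ) (f : ℝ → ℝ) : Set ℝ :=
  {t | t ∈ Icc 0 (tEps c₀ ε) ∧ |Real.log ε| ^ 3 * f (tEps c₀ ε) ≤ f t}

end SurfaceSC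

end

noncomputable section

open MeasureTheory Set

namespace SurfaceSC

/-! Write κ = εk, T = t_ε, A for the phase, w for the weight, l = |log ε|. A minimizer solves the
Euler–Lagrange equation with flux h = w f' vanishing at both ends, and minimality in α gives F(T) =
0 (Feynman–Hellmann).

For κ = 0 the equation has a first integral: G = -f'² + A² f² - (f² - f⁴/2)/b satisfies G' = 2 A f²
= F', so F(t) = G(t) - G(T). At an interior minimum m of (1 - d) f² + F one has (1 - d) f' = -A f,
so the first two terms of G(m) cancel up to O(A² d) f(m)², and the cost at m is at least (1 - 1/b -
o(1)) f(m)² - G(T), with G(T) ≤ A(T)² f(T)². As b > 1, the cost is at least -O(l²) f(T)²; this is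
`IsProfile.neg_le_cost`. The boundary term is paid for by using the defect d + l⁻³ instead of d: on
the region the spare l⁻³ f² is at least l³ f(T)².

The curvature errors in this comparison require f on [m, T] to be bounded by a multiple of f(m).
This Harnack bound (`IsProfile.le_harnackConst_mul`) is available when α lies in a fixed window [-M,
1]. In every other position of the potential well the profile vanishes, provided the region is
non-empty: for α ≥ 1 the potential is too high everywhere; for A(T) ≤ M one has f ≤ D f(T),
incompatible with the region unless f = 0; for α ≤ -M and A(T) ≥ M, comparison with the Gaussian
exp(-A²/2), of energy 1 > 1/b, excludes a non-zero solution (`IsProfile.eq_zero_of_phase_large`). -/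

/-- The curvature weight `1 - κ t`. -/
def weight (κ t : ℝ) : ℝ := 1 - κ * t

/-- The magnetic phase `t + α - κ t² / 2`. -/
def phase (κ α t : ℝ) : ℝ := t + α - κ / 2 * t ^ 2

lemma hasDerivAt_weight (κ t : ℝ) : HasDerivAt (weight κ) (-κ) t := by
  have := ((hasDerivAt_id t).const_mul κ).const_sub 1
  refine this.congr_deriv ?_
  simp

lemma hasDerivAt_phase (κ α t : ℝ) : HasDerivAt (phase κ α) (weight κ t) t := by
  have := ((hasDerivAt_id t).add_const α).sub (((hasDerivAt_id t).pow 2).const_mul (κ / 2))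
  refine this.congr_deriv ?_
  simp [weight]; ring

lemma continuous_weight (κ : ℝ) : Continuous (weight κ) := by unfold weight; fun_prop

lemma continuous_phase (κ α : ℝ) : Continuous (phase κ α) := by unfold phase; fun_prop

/-- A non-negative solution of the Euler–Lagrange equation with Neumann conditions, written as a
first order system for `f` and `h = (1 - κ t) f'`. -/
structure IsProfile (b κ α T : ℝ) (f h : ℝ → ℝ) : Prop where
  continuousOn : ContinuousOn f (Icc 0 T)
  continuousOn_flux : ContinuousOn h (Icc 0 T)
  flux_zero : h 0 = 0
  flux_end : h T = 0
  hasDerivAt : ∀ t ∈ Ioo 0 T, HasDerivAt f (h t / weight κ t) t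
  hasDerivAt_flux : ∀ t ∈ Ioo 0 T, HasDerivAt h
    ((phase κ α t ^ 2 / weight κ t - weight κ t / b * (1 - f t ^ 2)) * f t) t
  nonneg : ∀ t ∈ Icc 0 T, 0 ≤ f t

/-! ### Euler–Lagrange equation and Feynman–Hellmann identity -/

section Variational

variable {T : ℝ}

lemma hasDerivAt_integral_of_continuousOn {p : ℝ → ℝ} (hp : ContinuousOn p (Icc 0 T)) {t : ℝ}
    (ht : t ∈ Ioo 0 T) : HasDerivAt (fun x => ∫ s in (0 : ℝ)..x, p s) (p t) t := by
  apply intervalIntegral.integral_hasDerivAt_right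
  · apply ContinuousOn.intervalIntegrable
    rw [uIcc_of_le ht.1.le]
    exact hp.mono (Icc_subset_Icc le_rfl ht.2.le)
  · exact (hp.mono Ioo_subset_Icc_self).stronglyMeasurableAtFilter isOpen_Ioo t ht
  · exact hp.continuousAt (Icc_mem_nhds ht.1 ht.2)

lemma MemLp.intervalIntegrable_of_Icc (hT : 0 ≤ T) {g : ℝ → ℝ}
    (hg : MemLp g 2 (volume.restrict (Icc 0 T))) : IntervalIntegrable g volume 0 T := by
  rw [intervalIntegrable_iff_integrableOn_Icc_of_le hT]
  exact hg.integrable (by norm_num)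

lemma intervalIntegrable_mul_mul (hT : 0 ≤ T) {φ g₁ g₂ : ℝ → ℝ} (hφ : ContinuousOn φ (Icc 0 T))
    (h₁ : MemLp g₁ 2 (volume.restrict (Icc 0 T))) (h₂ : MemLp g₂ 2 (volume.restrict (Icc 0 T))) :
    IntervalIntegrable (fun t => φ t * (g₁ t * g₂ t)) volume 0 T := by
  have : IntervalIntegrable (fun t => g₁ t * g₂ t) volume 0 T := by
    rw [intervalIntegrable_iff_integrableOn_Icc_of_le hT]
    exact h₁.integrable_mul h₂
  exact this.continuousOn_mul (by rwa [uIcc_of_le hT])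

lemma MemH1.continuousOn (hT : 0 ≤ T) {f : ℝ → ℝ} (hf : MemH1 T f) :
    ContinuousOn f (Icc 0 T) := by
  have := hf.1.continuousOn
  rwa [uIcc_of_le hT] at this

lemma ae_deriv_primitive {g : ℝ → ℝ} (hg : IntervalIntegrable g volume 0 T) (hT : 0 ≤ T) :
    deriv (fun x => ∫ s in (0 : ℝ)..x, g s) =ᵐ[volume.restrict (Icc 0 T)] g := by
  rw [Filter.EventuallyEq, ae_restrict_iff' measurableSet_Icc]
  filter_upwards [hg.ae_hasDerivAt_integral] with x hx hx'
  rw [uIcc_of_le hT] at hx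
  exact (hx hx' 0 ⟨le_rfl, hT⟩).deriv

lemma memH1_primitive (hT : 0 ≤ T) {g : ℝ → ℝ} (hg : MemLp g 2 (volume.restrict (Icc 0 T))) :
    MemH1 T (fun x => ∫ s in (0 : ℝ)..x, g s) := by
  have hi := MemLp.intervalIntegrable_of_Icc hT hg
  exact ⟨hi.absolutelyContinuousOnInterval_intervalIntegral (by simp),
    (memLp_congr_ae (ae_deriv_primitive hi hT)).2 hg⟩

lemma memH1_one : MemH1 T (fun _ => 1) := by
  refine ⟨?_, by simp⟩
  exact (contDiff_const (c := (1 : ℝ))).contDiffOn.absolutelyContinuousOnInterval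

lemma ae_deriv_add_const_mul (hT : 0 ≤ T) {f η : ℝ → ℝ} (hf : MemH1 T f) (hη : MemH1 T η)
    (s : ℝ) : ∀ᵐ t, t ∈ Icc 0 T →
      deriv (fun x => f x + s * η x) t = deriv f t + s * deriv η t := by
  filter_upwards [hf.1.ae_differentiableAt, hη.1.ae_differentiableAt] with t h₁ h₂ ht
  rw [uIcc_of_le hT] at h₁ h₂
  exact ((h₁ ht).hasDerivAt.add ((h₂ ht).hasDerivAt.const_mul s)).deriv

lemma MemH1.add_const_mul (hT : 0 ≤ T) {f η : ℝ → ℝ} (hf : MemH1 T f) (hη : MemH1 T η)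
    (s : ℝ) : MemH1 T (fun x => f x + s * η x) := by
  refine ⟨hf.1.add (hη.1.const_mul s), ?_⟩
  have : deriv (fun x => f x + s * η x) =ᵐ[volume.restrict (Icc 0 T)]
      fun t => deriv f t + s * deriv η t := by
    rw [Filter.EventuallyEq, ae_restrict_iff' measurableSet_Icc]
    exact ae_deriv_add_const_mul hT hf hη s
  exact (memLp_congr_ae this).2 (hf.2.add (hη.2.const_mul s))

/-- Both first variations below, in the profile and in the phase, are of energies that are exactly
polynomial in the parameter, so a minimum at 0 kills the linear coefficient without differentiating
under an integral. -/
lemma linear_coeff_eq_zero {a₁ a₂ a₃ a₄ : ℝ}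
    (h : ∀ s : ℝ, 0 ≤ s * a₁ + s ^ 2 * a₂ + s ^ 3 * a₃ + s ^ 4 * a₄) : a₁ = 0 := by
  have hd : HasDerivAt (fun s : ℝ => s * a₁ + s ^ 2 * a₂ + s ^ 3 * a₃ + s ^ 4 * a₄) a₁ 0 := by
    have := ((((hasDerivAt_id (0 : ℝ)).mul_const a₁).add
      (((hasDerivAt_id (0 : ℝ)).pow 2).mul_const a₂)).add
      (((hasDerivAt_id (0 : ℝ)).pow 3).mul_const a₃)).add
      (((hasDerivAt_id (0 : ℝ)).pow 4).mul_const a₄)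
    refine this.congr_deriv ?_
    simp
  refine IsLocalMin.hasDerivAt_eq_zero (Filter.Eventually.of_forall fun s => ?_) hd
  simpa using h s

/-- The integrand of `∫ (1 - κ t) (f'² + A² / (1 - κ t)² f² - (2 f² - f⁴) / (2 b))`, with the
derivative of `f` as a separate argument. -/
def energyDensity (b κ α t y y' : ℝ) : ℝ :=
  weight κ t * (y' ^ 2 + phase κ α t ^ 2 / weight κ t ^ 2 * y ^ 2
    - 1 / (2 * b) * (2 * y ^ 2 - y ^ 4))

lemma energy_eq (b k c₀ ε α : ℝ) (f : ℝ → ℝ) : energy b k c₀ ε α f =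
    ∫ t in (0 : ℝ)..tEps c₀ ε, energyDensity b (ε * k) α t (f t) (deriv f t) := by
  simp only [energy, energyDensity, weight, phase]
  congr 1; ext t
  rw [show 1 / 2 * ε * k * t ^ 2 = ε * k / 2 * t ^ 2 by ring]

variable {b κ α : ℝ}

lemma continuousOn_potential (hw : ∀ t ∈ Icc 0 T, 0 < weight κ t) :
    ContinuousOn (fun t => phase κ α t ^ 2 / weight κ t ^ 2) (Icc 0 T) :=
  (((continuous_phase κ α).pow 2).continuousOn).div ((continuous_weight κ).pow 2).continuousOn
    fun t ht => pow_ne_zero 2 (hw t ht).ne'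

lemma intervalIntegrable_energyDensity (hT : 0 ≤ T) (hw : ∀ t ∈ Icc 0 T, 0 < weight κ t)
    {f : ℝ → ℝ} (hf : MemH1 T f) :
    IntervalIntegrable (fun t => energyDensity b κ α t (f t) (deriv f t)) volume 0 T := by
  have hfc := hf.continuousOn hT
  have hV := continuousOn_potential (α := α) hw
  have hwc := (continuous_weight κ).continuousOn (s := Icc 0 T)
  have h₁ := intervalIntegrable_mul_mul hT hwc hf.2 hf.2
  have h₂ : IntervalIntegrable (fun t => weight κ t * (phase κ α t ^ 2 / weight κ t ^ 2 * f t ^ 2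
      - 1 / (2 * b) * (2 * f t ^ 2 - f t ^ 4))) volume 0 T := by
    apply ContinuousOn.intervalIntegrable
    rw [uIcc_of_le hT]
    fun_prop
  refine (h₁.add h₂).congr fun t _ => ?_
  simp only [energyDensity]; ring

/-- Weak form of the Euler–Lagrange equation. -/
lemma weak_eulerLagrange (hT : 0 ≤ T) (hw : ∀ t ∈ Icc 0 T, 0 < weight κ t) {f : ℝ → ℝ}
    (hf : MemH1 T f)
    (hmin : ∀ g, MemH1 T g → ∫ t in (0 : ℝ)..T, energyDensity b κ α t (f t) (deriv f t) ≤
      ∫ t in (0 : ℝ)..T, energyDensity b κ α t (g t) (deriv g t))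
    {η : ℝ → ℝ} (hη : MemH1 T η) :
    ∫ t in (0 : ℝ)..T, (weight κ t * (deriv f t * deriv η t) +
      (phase κ α t ^ 2 / weight κ t - weight κ t / b * (1 - f t ^ 2)) * f t * η t) = 0 := by
  have hfc := hf.continuousOn hT
  have hηc := hη.continuousOn hT
  have hV := continuousOn_potential (α := α) hw
  have hwc := (continuous_weight κ).continuousOn (s := Icc 0 T)
  have hc : ∀ q : ℝ → ℝ, ContinuousOn q (Icc 0 T) → IntervalIntegrable q volume 0 T := by
    intro q hq
    apply ContinuousOn.intervalIntegrable
    rwa [uIcc_of_le hT]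
  set G₁ : ℝ → ℝ := fun t => 2 * (weight κ t * (deriv f t * deriv η t)) +
    weight κ t * (2 * (phase κ α t ^ 2 / weight κ t ^ 2) * f t * η t
      - 2 / b * (f t * η t - f t ^ 3 * η t)) with hG₁
  set G₂ : ℝ → ℝ := fun t => weight κ t * (deriv η t * deriv η t) +
    weight κ t * ((phase κ α t ^ 2 / weight κ t ^ 2) * η t ^ 2
      - 1 / b * (η t ^ 2 - 3 * f t ^ 2 * η t ^ 2)) with hG₂
  set G₃ : ℝ → ℝ := fun t => weight κ t * (2 / b * (f t * η t ^ 3)) with hG₃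
  set G₄ : ℝ → ℝ := fun t => weight κ t * (1 / (2 * b) * η t ^ 4) with hG₄
  have i₀ := intervalIntegrable_energyDensity (b := b) (α := α) hT hw hf
  have i₁ : IntervalIntegrable G₁ volume 0 T :=
    ((intervalIntegrable_mul_mul hT hwc hf.2 hη.2).const_mul 2).add (hc _ (by fun_prop))
  have i₂ : IntervalIntegrable G₂ volume 0 T :=
    (intervalIntegrable_mul_mul hT hwc hη.2 hη.2).add (hc _ (by fun_prop))
  have i₃ : IntervalIntegrable G₃ volume 0 T := hc _ (by fun_prop)
  have i₄ : IntervalIntegrable G₄ volume 0 T := hc _ (by fun_prop)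
  have hexp : ∀ s : ℝ, ∫ t in (0 : ℝ)..T, energyDensity b κ α t (f t + s * η t)
      (deriv (fun x => f x + s * η x) t) =
      (∫ t in (0 : ℝ)..T, energyDensity b κ α t (f t) (deriv f t)) +
      s * (∫ t in (0 : ℝ)..T, G₁ t) + s ^ 2 * (∫ t in (0 : ℝ)..T, G₂ t) +
      s ^ 3 * (∫ t in (0 : ℝ)..T, G₃ t) + s ^ 4 * (∫ t in (0 : ℝ)..T, G₄ t) := by
    intro s
    rw [← intervalIntegral.integral_const_mul, ← intervalIntegral.integral_const_mul,
      ← intervalIntegral.integral_const_mul, ← intervalIntegral.integral_const_mul,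
      ← intervalIntegral.integral_add i₀ (i₁.const_mul _),
      ← intervalIntegral.integral_add (i₀.add (i₁.const_mul _)) (i₂.const_mul _),
      ← intervalIntegral.integral_add ((i₀.add (i₁.const_mul _)).add (i₂.const_mul _))
        (i₃.const_mul _),
      ← intervalIntegral.integral_add (((i₀.add (i₁.const_mul _)).add (i₂.const_mul _)).add
        (i₃.const_mul _)) (i₄.const_mul _)]
    apply intervalIntegral.integral_congr_ae
    filter_upwards [ae_deriv_add_const_mul hT hf hη s] with t ht ht'
    rw [uIoc_of_le hT] at ht'
    rw [ht (Ioc_subset_Icc_self ht')]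
    simp only [energyDensity, hG₁, hG₂, hG₃, hG₄]
    -- No sign of b is assumed here; for b = 0 the convention 1/0 = 0 removes the nonlinear terms.
    by_cases hb : b = 0
    · subst hb; simp; ring
    · field_simp; ring
  have h0 : ∫ t in (0 : ℝ)..T, G₁ t = 0 := by
    refine linear_coeff_eq_zero (a₂ := ∫ t in (0 : ℝ)..T, G₂ t) (a₃ := ∫ t in (0 : ℝ)..T, G₃ t)
      (a₄ := ∫ t in (0 : ℝ)..T, G₄ t) fun s => ?_
    have := hmin _ (hf.add_const_mul hT hη s)
    rw [hexp s] at this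
    linarith
  have : ∫ t in (0 : ℝ)..T, (2 : ℝ)⁻¹ * G₁ t = 0 := by
    rw [intervalIntegral.integral_const_mul, h0, mul_zero]
  refine Eq.trans ?_ this
  apply intervalIntegral.integral_congr
  intro t ht
  rw [uIcc_of_le hT] at ht
  have := (hw t ht).ne'
  simp only [hG₁]
  by_cases hb : b = 0
  · subst hb; simp; field_simp
  · field_simp

/-- A non-negative minimizer solves the Euler–Lagrange equation in the classical sense. -/
lemma exists_isProfile (hT : 0 < T) (hw : ∀ t ∈ Icc 0 T, 0 < weight κ t) {f : ℝ → ℝ}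
    (hf : MemH1 T f) (hnn : ∀ t ∈ Icc 0 T, 0 ≤ f t)
    (hmin : ∀ g, MemH1 T g → ∫ t in (0 : ℝ)..T, energyDensity b κ α t (f t) (deriv f t) ≤
      ∫ t in (0 : ℝ)..T, energyDensity b κ α t (g t) (deriv g t)) :
    ∃ h, IsProfile b κ α T f h := by
  have hfc := hf.continuousOn hT.le
  have hwc := (continuous_weight κ).continuousOn (s := Icc 0 T)
  have hw0 : ∀ t ∈ Icc 0 T, weight κ t ≠ 0 := fun t ht => (hw t ht).ne'
  set p : ℝ → ℝ := fun t =>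
    (phase κ α t ^ 2 / weight κ t - weight κ t / b * (1 - f t ^ 2)) * f t with hp
  have hpc : ContinuousOn p (Icc 0 T) := by
    have : ContinuousOn (fun t => phase κ α t ^ 2 / weight κ t) (Icc 0 T) :=
      ((continuous_phase κ α).pow 2).continuousOn.div hwc hw0
    fun_prop
  have hpi : IntervalIntegrable p volume 0 T := by
    apply ContinuousOn.intervalIntegrable
    rwa [uIcc_of_le hT.le]
  set h : ℝ → ℝ := fun x => ∫ s in (0 : ℝ)..x, p s with hh
  have hAC : AbsolutelyContinuousOnInterval h 0 T :=
    hpi.absolutelyContinuousOnInterval_intervalIntegral (by simp)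
  have hhc : ContinuousOn h (Icc 0 T) := by
    have := hAC.continuousOn
    rwa [uIcc_of_le hT.le] at this
  have hh' : deriv h =ᵐ[volume.restrict (Icc 0 T)] p := ae_deriv_primitive hpi hT.le
  have hEL := fun η hη => weak_eulerLagrange (η := η) hT.le hw hf hmin hη
  -- Testing with the constant 1 yields the natural Neumann condition at T.
  have hhT : h T = 0 := by
    have := hEL _ memH1_one
    simpa [hh, hp] using this
  -- Du Bois-Reymond argument: the test function η with η' = g turns the weak equation into ∫ g² =
  -- 0. The integration by parts has no boundary term because h vanishes at both ends. Hence w f' =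
  -- h almost everywhere, and f is a primitive of the continuous function h / w.
  set g : ℝ → ℝ := fun t => weight κ t * deriv f t - h t with hg
  have hgL : MemLp g 2 (volume.restrict (Icc 0 T)) := by
    obtain ⟨Cw, hCw⟩ := isCompact_Icc.exists_bound_of_continuousOn hwc
    refine MemLp.sub ?_ ?_
    · refine hf.2.of_le_mul (c := Cw)
        ((continuous_weight κ).aestronglyMeasurable.mul hf.2.aestronglyMeasurable) ?_
      rw [ae_restrict_iff' measurableSet_Icc]
      refine Filter.Eventually.of_forall fun t ht => ?_
      rw [norm_mul]
      exact mul_le_mul_of_nonneg_right (hCw t ht) (norm_nonneg _)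
    · obtain ⟨Ch, hCh⟩ := isCompact_Icc.exists_bound_of_continuousOn hhc
      refine MemLp.of_bound (hhc.aestronglyMeasurable measurableSet_Icc) Ch ?_
      rw [ae_restrict_iff' measurableSet_Icc]
      exact Filter.Eventually.of_forall hCh
  set η : ℝ → ℝ := fun x => ∫ s in (0 : ℝ)..x, g s with hη
  have hηH : MemH1 T η := memH1_primitive hT.le hgL
  have hη' : deriv η =ᵐ[volume.restrict (Icc 0 T)] g :=
    ae_deriv_primitive (MemLp.intervalIntegrable_of_Icc hT.le hgL) hT.le
  have hparts : ∫ t in (0 : ℝ)..T, h t * g t = - ∫ t in (0 : ℝ)..T, p t * η t := by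
    have h1 := hAC.integral_mul_deriv_eq_deriv_mul hηH.1
    have h2 : ∫ t in (0 : ℝ)..T, h t * deriv η t = ∫ t in (0 : ℝ)..T, h t * g t := by
      apply intervalIntegral.integral_congr_ae
      rw [Filter.EventuallyEq, ae_restrict_iff' measurableSet_Icc] at hη'
      filter_upwards [hη'] with t ht ht'
      rw [uIoc_of_le hT.le] at ht'
      rw [ht (Ioc_subset_Icc_self ht')]
    have h3 : ∫ t in (0 : ℝ)..T, deriv h t * η t = ∫ t in (0 : ℝ)..T, p t * η t := by
      apply intervalIntegral.integral_congr_ae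
      rw [Filter.EventuallyEq, ae_restrict_iff' measurableSet_Icc] at hh'
      filter_upwards [hh'] with t ht ht'
      rw [uIoc_of_le hT.le] at ht'
      rw [ht (Ioc_subset_Icc_self ht')]
    rw [h2, h3, hhT] at h1
    simpa [hh] using h1
  have hgg : ∫ t in (0 : ℝ)..T, g t * g t = 0 := by
    have h1 := hEL η hηH
    have i1 := intervalIntegrable_mul_mul hT.le hwc hf.2 hgL
    have i2 : IntervalIntegrable (fun t => p t * η t) volume 0 T := by
      apply ContinuousOn.intervalIntegrable
      rw [uIcc_of_le hT.le]
      exact hpc.mul (hηH.continuousOn hT.le)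
    have i3 : IntervalIntegrable (fun t => h t * g t) volume 0 T := by
      refine (MemLp.intervalIntegrable_of_Icc hT.le hgL).continuousOn_mul ?_
      rwa [uIcc_of_le hT.le]
    have h2 : ∫ t in (0 : ℝ)..T, (weight κ t * (deriv f t * g t) + p t * η t) = 0 := by
      refine Eq.trans ?_ h1
      apply intervalIntegral.integral_congr_ae
      rw [Filter.EventuallyEq, ae_restrict_iff' measurableSet_Icc] at hη'
      filter_upwards [hη'] with t ht ht'
      rw [uIoc_of_le hT.le] at ht'
      rw [ht (Ioc_subset_Icc_self ht')]
    rw [intervalIntegral.integral_add i1 i2] at h2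
    have h3 : ∫ t in (0 : ℝ)..T, g t * g t =
        (∫ t in (0 : ℝ)..T, weight κ t * (deriv f t * g t)) - ∫ t in (0 : ℝ)..T, h t * g t := by
      rw [← intervalIntegral.integral_sub i1 i3]
      congr 1; ext t; simp only [hg]; ring
    rw [h3, hparts]; linarith
  have hg0 : g =ᵐ[volume.restrict (Icc 0 T)] 0 := by
    have hi : Integrable (fun t => g t * g t) (volume.restrict (Icc 0 T)) := hgL.integrable_mul hgL
    rw [intervalIntegral.integral_of_le hT.le, ← integral_Icc_eq_integral_Ioc,
      integral_eq_zero_iff_of_nonneg (fun t => mul_self_nonneg _) hi] at hgg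
    filter_upwards [hgg] with t ht
    simpa using ht
  have hfint : ∀ x ∈ Icc 0 T, f x = f 0 + ∫ t in (0 : ℝ)..x, h t / weight κ t := by
    intro x hx
    have hACx : AbsolutelyContinuousOnInterval f 0 x := by
      refine hf.1.mono ?_
      rw [uIcc_of_le hx.1, uIcc_of_le hT.le]
      exact Icc_subset_Icc le_rfl hx.2
    have h1 := hACx.integral_deriv_eq_sub
    have h2 : ∫ t in (0 : ℝ)..x, deriv f t = ∫ t in (0 : ℝ)..x, h t / weight κ t := by
      apply intervalIntegral.integral_congr_ae
      rw [Filter.EventuallyEq, ae_restrict_iff' measurableSet_Icc] at hg0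
      filter_upwards [hg0] with t ht ht'
      rw [uIoc_of_le hx.1] at ht'
      have ht'' : t ∈ Icc 0 T := ⟨ht'.1.le, ht'.2.trans hx.2⟩
      have h3 := ht ht''
      simp only [hg, Pi.zero_apply] at h3
      rw [eq_div_iff (hw0 t ht'')]
      linarith
    rw [← h2]; linarith
  refine ⟨h, hfc, hhc, by simp [hh], hhT, fun t ht => ?_, fun t ht => ?_, hnn⟩
  · have h1 := (hasDerivAt_integral_of_continuousOn (hhc.div hwc hw0) ht).const_add (f 0)
    refine h1.congr_of_eventuallyEq ?_
    filter_upwards [Icc_mem_nhds ht.1 ht.2] with x hx using hfint x hx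
  · exact hasDerivAt_integral_of_continuousOn hpc ht

/-- The energy density is bounded from below. -/
lemma neg_le_energyDensity (hb : 0 < b) {t : ℝ} (hw0 : 0 ≤ weight κ t) (hw1 : weight κ t ≤ 1)
    (y y' : ℝ) : -(1 / (2 * b)) ≤ energyDensity b κ α t y y' := by
  have h1 : 0 ≤ 1 / (2 * b) := by positivity
  have h2 : 2 * y ^ 2 - y ^ 4 ≤ 1 := by nlinarith [sq_nonneg (y ^ 2 - 1)]
  have h3 : 0 ≤ phase κ α t ^ 2 / weight κ t ^ 2 * y ^ 2 := by positivity
  have h4 : -(1 / (2 * b)) ≤ y' ^ 2 + phase κ α t ^ 2 / weight κ t ^ 2 * y ^ 2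
    - 1 / (2 * b) * (2 * y ^ 2 - y ^ 4) := by nlinarith [sq_nonneg y']
  unfold energyDensity
  nlinarith

lemma potentialF_eq (k ε α : ℝ) (f : ℝ → ℝ) (t : ℝ) : potentialF k ε α f t =
    2 * ∫ η in (0 : ℝ)..t, phase (ε * k) α η / weight (ε * k) η * f η ^ 2 := by
  unfold potentialF
  congr 2; ext η
  rw [show 1 / 2 * ε * k * η ^ 2 = ε * k / 2 * η ^ 2 by ring]
  change weight (ε * k) η * f η ^ 2 * (phase (ε * k) α η / weight (ε * k) η ^ 2) = _
  by_cases h : weight (ε * k) η = 0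
  · simp [h]
  · field_simp

/-- Feynman–Hellmann: at an optimal phase the potential function vanishes at the end point. -/
lemma IsOptimal.potentialF_end {b k c₀ ε α : ℝ} {f : ℝ → ℝ} (hb : 0 < b)
    (hT : 0 ≤ tEps c₀ ε) (hw : ∀ t ∈ Icc 0 (tEps c₀ ε), 0 < weight (ε * k) t)
    (hw1 : ∀ t ∈ Icc 0 (tEps c₀ ε), weight (ε * k) t ≤ 1) (hf : IsOptimal b k c₀ ε α f) :
    potentialF k ε α f (tEps c₀ ε) = 0 := by
  set T := tEps c₀ ε with hTdef
  set κ := ε * k with hκ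
  have hfc := hf.memH1.continuousOn hT
  have hwc := (continuous_weight κ).continuousOn (s := Icc 0 T)
  have hw0 : ∀ t ∈ Icc 0 T, weight κ t ≠ 0 := fun t ht => (hw t ht).ne'
  -- The infimum over profiles must be bounded below, since otherwise `sInf` would take a default
  -- value and not compare with the energies.
  have hbdd : ∀ α' : ℝ, ∀ g, MemH1 T g →
      -(1 / (2 * b)) * T ≤ energy b k c₀ ε α' g := by
    intro α' g hg
    rw [energy_eq]
    have h1 : ∫ _ in (0 : ℝ)..T, -(1 / (2 * b)) = -(1 / (2 * b)) * T := by
      simp; ring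
    rw [← h1]
    refine intervalIntegral.integral_mono_on hT (by simp)
      (intervalIntegrable_energyDensity hT hw hg) fun t ht => ?_
    exact neg_le_energyDensity hb (hw t ht).le (hw1 t ht) _ _
  have hground : groundEnergy b k c₀ ε α = energy b k c₀ ε α f := by
    refine IsLeast.csInf_eq ⟨⟨f, hf.memH1, rfl⟩, ?_⟩
    rintro _ ⟨g, hg, rfl⟩
    exact hf.isMinOn_profile hg
  have hle : ∀ s : ℝ, energy b k c₀ ε α f ≤ energy b k c₀ ε (α + s) f := by
    intro s
    rw [← hground]
    refine (hf.isMinOn_phase (mem_univ (α + s))).trans (csInf_le ⟨-(1 / (2 * b)) * T, ?_⟩ ?_)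
    · rintro _ ⟨g, hg, rfl⟩
      exact hbdd _ g hg
    · exact ⟨f, hf.memH1, rfl⟩
  have hc : ∀ q : ℝ → ℝ, ContinuousOn q (Icc 0 T) → IntervalIntegrable q volume 0 T := by
    intro q hq
    apply ContinuousOn.intervalIntegrable
    rwa [uIcc_of_le hT]
  have hAw : ContinuousOn (fun t => phase κ α t / weight κ t) (Icc 0 T) :=
    (continuous_phase κ α).continuousOn.div hwc hw0
  have i₁ : IntervalIntegrable (fun t => 2 * (phase κ α t / weight κ t * f t ^ 2)) volume 0 T :=
    hc _ (by fun_prop)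
  have i₂ : IntervalIntegrable (fun t => f t ^ 2 / weight κ t) volume 0 T :=
    hc _ ((hfc.pow 2).div hwc hw0)
  have i₀ := intervalIntegrable_energyDensity (b := b) (α := α) hT hw hf.memH1
  -- With f frozen, the energy is quadratic in the shift of the phase, and its linear coefficient is
  -- F(T).
  have hexp : ∀ s : ℝ, energy b k c₀ ε (α + s) f = energy b k c₀ ε α f +
      s * (∫ t in (0 : ℝ)..T, 2 * (phase κ α t / weight κ t * f t ^ 2)) +
      s ^ 2 * ∫ t in (0 : ℝ)..T, f t ^ 2 / weight κ t := by
    intro s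
    rw [energy_eq, energy_eq, ← intervalIntegral.integral_const_mul,
      ← intervalIntegral.integral_const_mul,
      ← intervalIntegral.integral_add i₀ (i₁.const_mul _),
      ← intervalIntegral.integral_add (i₀.add (i₁.const_mul _)) (i₂.const_mul _)]
    apply intervalIntegral.integral_congr
    intro t ht
    rw [uIcc_of_le hT] at ht
    have h1 := hw0 t ht
    have h2 : phase κ (α + s) t = phase κ α t + s := by unfold phase; ring
    simp only [energyDensity, ← hκ, h2]
    field_simp
    ring
  have := linear_coeff_eq_zero (a₁ := ∫ t in (0 : ℝ)..T, 2 * (phase κ α t / weight κ t * f t ^ 2))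
    (a₂ := ∫ t in (0 : ℝ)..T, f t ^ 2 / weight κ t) (a₃ := 0) (a₄ := 0) fun s => by
      have h1 := hle s
      rw [hexp s] at h1
      linarith
  rw [potentialF_eq, ← intervalIntegral.integral_const_mul]
  exact this

lemma IsOptimal.exists_isProfile {b k c₀ ε α : ℝ} {f : ℝ → ℝ}
    (hT : 0 < tEps c₀ ε) (hw : ∀ t ∈ Icc 0 (tEps c₀ ε), 0 < weight (ε * k) t)
    (hf : IsOptimal b k c₀ ε α f) : ∃ h, IsProfile b (ε * k) α (tEps c₀ ε) f h := by
  refine SurfaceSC.exists_isProfile hT hw hf.memH1 hf.nonneg fun g hg => ?_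
  have := hf.isMinOn_profile hg
  simpa only [mem_ofPred_eq, energy_eq] using this

end Variational

/-! ### Monotonicity and logarithmic derivative bounds for profiles -/

section Profile

variable {b κ α T : ℝ} {f h : ℝ → ℝ}

lemma weight_mem (hκ : 0 ≤ κ) (hκT : κ * T ≤ 1 / 2) {t : ℝ} (ht : t ∈ Icc 0 T) :
    weight κ t ∈ Icc (1 / 2) 1 := by
  have h1 : κ * t ≤ κ * T := mul_le_mul_of_nonneg_left ht.2 hκ
  have h2 : 0 ≤ κ * t := mul_nonneg hκ ht.1
  unfold weight
  constructor <;> linarith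

/-- The phase moves at speed w, up to a factor 2 the unit speed; this converts distances along the
interval into values of the phase. -/
lemma phase_sub_mem (hκ : 0 ≤ κ) (hκT : κ * T ≤ 1 / 2) {s t : ℝ} (hs : 0 ≤ s) (hst : s ≤ t)
    (ht : t ≤ T) : phase κ α t - phase κ α s ∈ Icc ((t - s) / 2) (t - s) := by
  have h1 : phase κ α t - phase κ α s = (t - s) * (1 - κ * (t + s) / 2) := by
    unfold phase; ring
  have h2 : κ * (t + s) ≤ 1 := by
    have := mul_le_mul_of_nonneg_left (show t + s ≤ 2 * T by linarith) hκ
    linarith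
  have h3 : 0 ≤ κ * (t + s) := mul_nonneg hκ (by linarith)
  rw [h1]
  constructor <;> nlinarith [sub_nonneg.2 hst]

lemma phase_zero : phase κ α 0 = α := by simp [phase]

namespace IsProfile

lemma monotoneOn_of_flux_nonneg (P : IsProfile b κ α T f h) (hκ : 0 ≤ κ) (hκT : κ * T ≤ 1 / 2)
    {a c : ℝ} (ha : 0 ≤ a) (hc : c ≤ T) (hh : ∀ t ∈ Ioo a c, 0 ≤ h t) :
    MonotoneOn f (Icc a c) := by
  refine monotoneOn_of_hasDerivWithinAt_nonneg (f' := fun t => h t / weight κ t)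
    (convex_Icc a c) (P.continuousOn.mono (Icc_subset_Icc ha hc)) ?_ ?_
  · rw [interior_Icc]
    exact fun t ht => (P.hasDerivAt t ⟨ha.trans_lt ht.1, ht.2.trans_le hc⟩).hasDerivWithinAt
  · rw [interior_Icc]
    intro t ht
    have := (weight_mem hκ hκT (t := t) ⟨ha.trans ht.1.le, ht.2.le.trans hc⟩).1
    exact div_nonneg (hh t ht) (by linarith)

lemma antitoneOn_of_flux_nonpos (P : IsProfile b κ α T f h) (hκ : 0 ≤ κ) (hκT : κ * T ≤ 1 / 2)
    {a c : ℝ} (ha : 0 ≤ a) (hc : c ≤ T) (hh : ∀ t ∈ Ioo a c, h t ≤ 0) :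
    AntitoneOn f (Icc a c) := by
  refine antitoneOn_of_hasDerivWithinAt_nonpos (f' := fun t => h t / weight κ t)
    (convex_Icc a c) (P.continuousOn.mono (Icc_subset_Icc ha hc)) ?_ ?_
  · rw [interior_Icc]
    exact fun t ht => (P.hasDerivAt t ⟨ha.trans_lt ht.1, ht.2.trans_le hc⟩).hasDerivWithinAt
  · rw [interior_Icc]
    intro t ht
    have := (weight_mem hκ hκT (t := t) ⟨ha.trans ht.1.le, ht.2.le.trans hc⟩).1
    exact div_nonpos_of_nonpos_of_nonneg (hh t ht) (by linarith)

/-- Where the phase is at least one in absolute value, the flux is non-decreasing. -/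
lemma flux_monotoneOn (P : IsProfile b κ α T f h) (hb : 1 ≤ b) (hκ : 0 ≤ κ)
    (hκT : κ * T ≤ 1 / 2) {a c : ℝ} (ha : 0 ≤ a) (hc : c ≤ T)
    (hA : ∀ t ∈ Ioo a c, 1 ≤ phase κ α t ^ 2) : MonotoneOn h (Icc a c) := by
  refine monotoneOn_of_hasDerivWithinAt_nonneg (f' := fun t =>
    (phase κ α t ^ 2 / weight κ t - weight κ t / b * (1 - f t ^ 2)) * f t)
    (convex_Icc a c) (P.continuousOn_flux.mono (Icc_subset_Icc ha hc)) ?_ ?_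
  · rw [interior_Icc]
    exact fun t ht => (P.hasDerivAt_flux t ⟨ha.trans_lt ht.1, ht.2.trans_le hc⟩).hasDerivWithinAt
  · rw [interior_Icc]
    intro t ht
    have htT : t ∈ Icc 0 T := ⟨ha.trans ht.1.le, ht.2.le.trans hc⟩
    obtain ⟨w1, w2⟩ := weight_mem hκ hκT htT
    refine mul_nonneg ?_ (P.nonneg t htT)
    have h1 : 1 ≤ phase κ α t ^ 2 / weight κ t := by
      rw [le_div_iff₀ (by linarith)]
      linarith [hA t ht]
    have h2 : weight κ t / b ≤ 1 := by
      rw [div_le_one (by linarith)]; linarith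
    have h3 : 0 ≤ weight κ t / b := by positivity
    nlinarith [sq_nonneg (f t)]

/-- Maximum principle through the flux. At a maximum point the flux vanishes, by the Neumann
condition if the point is an end point. If the maximum exceeded 1, then h' > 0 nearby, and f would
strictly increase on moving away from that point. -/
lemma le_one (P : IsProfile b κ α T f h) (hb : 1 ≤ b) (hκ : 0 ≤ κ) (hκT : κ * T ≤ 1 / 2)
    (hT : 0 < T) : ∀ t ∈ Icc 0 T, f t ≤ 1 := by
  obtain ⟨m, hm, hmax⟩ := isCompact_Icc.exists_isMaxOn (nonempty_Icc.2 hT.le) P.continuousOn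
  refine fun t ht => (hmax ht).trans ?_
  by_contra! hgt
  have hhm : h m = 0 := by
    rcases hm.1.eq_or_lt with h0 | h0
    · rw [← h0, P.flux_zero]
    rcases hm.2.eq_or_lt with h1 | h1
    · rw [h1, P.flux_end]
    have hloc : IsLocalMax f m := hmax.isLocalMax (Icc_mem_nhds h0 h1)
    have := hloc.hasDerivAt_eq_zero (P.hasDerivAt m ⟨h0, h1⟩)
    have hw := (weight_mem hκ hκT hm).1
    rcases div_eq_zero_iff.1 this with h2 | h2
    · exact h2
    · linarith
  have hnear : ∃ r > 0, ∀ t ∈ Icc 0 T, |t - m| < r → 1 < f t := by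
    have := (P.continuousOn m hm).eventually (lt_mem_nhds hgt)
    rw [eventually_nhdsWithin_iff, Metric.eventually_nhds_iff] at this
    obtain ⟨r, hr, h1⟩ := this
    exact ⟨r, hr, fun t ht htr => h1 (by rwa [Real.dist_eq]) ht⟩
  obtain ⟨r, hr, hf1⟩ := hnear
  have hstrict : ∀ a c, 0 ≤ a → c ≤ T → (∀ t ∈ Ioo a c, 1 < f t) → StrictMonoOn h (Icc a c) := by
    intro a c ha hc h1
    refine strictMonoOn_of_hasDerivWithinAt_pos (f' := fun t =>
      (phase κ α t ^ 2 / weight κ t - weight κ t / b * (1 - f t ^ 2)) * f t)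
      (convex_Icc a c) (P.continuousOn_flux.mono (Icc_subset_Icc ha hc)) ?_ ?_
    · rw [interior_Icc]
      exact fun t ht =>
        (P.hasDerivAt_flux t ⟨ha.trans_lt ht.1, ht.2.trans_le hc⟩).hasDerivWithinAt
    · rw [interior_Icc]
      intro t ht
      have hw := (weight_mem hκ hκT (t := t) ⟨ha.trans ht.1.le, ht.2.le.trans hc⟩).1
      have hf := h1 t ht
      refine mul_pos ?_ (by linarith)
      have h2 : 0 ≤ phase κ α t ^ 2 / weight κ t := by positivity
      have h3 : 0 < weight κ t / b := by positivity
      have h4 : 1 - f t ^ 2 < 0 := by nlinarith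
      linarith [mul_neg_of_pos_of_neg h3 h4]
  rcases hm.2.eq_or_lt with h1 | h1
  · obtain ⟨s, hs1, hs2⟩ : ∃ s, max 0 (m - r) < s ∧ s < m :=
      exists_between (max_lt (by linarith) (by linarith))
    have hs0 := (le_max_left _ _).trans_lt hs1
    have hsr := (le_max_right _ _).trans_lt hs1
    have hh := hstrict s m hs0.le hm.2 fun t ht => hf1 t ⟨by linarith [ht.1], by linarith [ht.2]⟩
      (by rw [abs_lt]; constructor <;> linarith [ht.1, ht.2])
    have : StrictAntiOn f (Icc s m) := by
      refine strictAntiOn_of_hasDerivWithinAt_neg (f' := fun t => h t / weight κ t)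
        (convex_Icc s m) (P.continuousOn.mono (Icc_subset_Icc hs0.le hm.2)) ?_ ?_
      · rw [interior_Icc]
        exact fun t ht =>
          (P.hasDerivAt t ⟨hs0.trans ht.1, ht.2.trans_le hm.2⟩).hasDerivWithinAt
      · rw [interior_Icc]
        intro t ht
        have hw := (weight_mem hκ hκT (t := t) ⟨by linarith [ht.1], by linarith [ht.2]⟩).1
        have := hh ⟨ht.1.le, ht.2.le⟩ ⟨hs2.le, le_rfl⟩ ht.2
        exact div_neg_of_neg_of_pos (by linarith) (by linarith)
    have h2 := this ⟨le_rfl, hs2.le⟩ ⟨hs2.le, le_rfl⟩ hs2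
    have h3 : f s ≤ f m := hmax ⟨hs0.le, by linarith⟩
    linarith
  · obtain ⟨s, hs1, hs2⟩ : ∃ s, m < s ∧ s < min T (m + r) :=
      exists_between (lt_min (by linarith) (by linarith))
    have hsT := hs2.trans_le (min_le_left _ _)
    have hsr := hs2.trans_le (min_le_right _ _)
    have hh := hstrict m s hm.1 hsT.le fun t ht =>
      hf1 t ⟨by linarith [ht.1, hm.1], by linarith [ht.2]⟩
      (by rw [abs_lt]; constructor <;> linarith [ht.1, ht.2])
    have : StrictMonoOn f (Icc m s) := by
      refine strictMonoOn_of_hasDerivWithinAt_pos (f' := fun t => h t / weight κ t)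
        (convex_Icc m s) (P.continuousOn.mono (Icc_subset_Icc hm.1 hsT.le)) ?_ ?_
      · rw [interior_Icc]
        exact fun t ht =>
          (P.hasDerivAt t ⟨hm.1.trans_lt ht.1, ht.2.trans hsT⟩).hasDerivWithinAt
      · rw [interior_Icc]
        intro t ht
        have hw := (weight_mem hκ hκT (t := t)
          ⟨by linarith [ht.1, hm.1], by linarith [ht.2]⟩).1
        have := hh ⟨le_rfl, hs1.le⟩ ⟨ht.1.le, ht.2.le⟩ ht.1
        exact div_pos (by linarith) (by linarith)
    have h2 := this ⟨le_rfl, hs1.le⟩ ⟨hs1.le, le_rfl⟩ hs1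
    have h3 : f s ≤ f m := hmax ⟨by linarith [hm.1], hsT.le⟩
    linarith

/-- If the phase exceeds one in absolute value throughout, the profile vanishes. -/
lemma eq_zero_of_one_le_phase (P : IsProfile b κ α T f h) (hb : 1 < b) (hκ : 0 ≤ κ)
    (hκT : κ * T ≤ 1 / 2) (hT : 0 < T) (hA : ∀ t ∈ Ioo 0 T, 1 ≤ phase κ α t ^ 2) :
    ∀ t ∈ Icc 0 T, f t = 0 := by
  have hmono := P.flux_monotoneOn hb.le hκ hκT le_rfl le_rfl hA
  have hzero : ∀ t ∈ Icc 0 T, h t = 0 := by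
    intro t ht
    have h1 := hmono ⟨le_rfl, hT.le⟩ ht ht.1
    have h2 := hmono ht ⟨hT.le, le_rfl⟩ ht.2
    rw [P.flux_zero] at h1
    rw [P.flux_end] at h2
    linarith
  have hm : T / 2 ∈ Ioo 0 T := ⟨by linarith, by linarith⟩
  -- The flux is identically zero, so f is constant. Also h' = 0 at the midpoint, where the
  -- coefficient of f is positive because b > 1; that constant is therefore 0.
  have hhalf : f (T / 2) = 0 := by
    have h1 : HasDerivAt h 0 (T / 2) := by
      refine (hasDerivAt_const (T / 2) (0 : ℝ)).congr_of_eventuallyEq ?_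
      filter_upwards [Icc_mem_nhds hm.1 hm.2] with x hx using hzero x hx
    have h2 := (P.hasDerivAt_flux _ hm).unique h1
    refine (mul_eq_zero.1 h2).resolve_left (ne_of_gt ?_)
    obtain ⟨w1, w2⟩ := weight_mem hκ hκT (Ioo_subset_Icc_self hm)
    have h3 : 1 ≤ phase κ α (T / 2) ^ 2 / weight κ (T / 2) := by
      rw [le_div_iff₀ (by linarith)]
      linarith [hA _ hm]
    have h4 : weight κ (T / 2) / b < 1 := by
      rw [div_lt_one (by linarith)]; linarith
    have h5 : 0 ≤ weight κ (T / 2) / b := by positivity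
    nlinarith [sq_nonneg (f (T / 2))]
  have m1 := P.monotoneOn_of_flux_nonneg hκ hκT le_rfl le_rfl
    fun t ht => (hzero t (Ioo_subset_Icc_self ht)).ge
  have m2 := P.antitoneOn_of_flux_nonpos hκ hκT le_rfl le_rfl
    fun t ht => (hzero t (Ioo_subset_Icc_self ht)).le
  intro t ht
  rcases le_total t (T / 2) with h1 | h1
  · linarith [m1 ht (Ioo_subset_Icc_self hm) h1, m2 ht (Ioo_subset_Icc_self hm) h1]
  · linarith [m1 (Ioo_subset_Icc_self hm) ht h1, m2 (Ioo_subset_Icc_self hm) ht h1]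

/-- This is w^(-R/κ), the integrating factor with logarithmic derivative R / w. It turns (h - R f)'
≤ -(R/w)(h - R f) into monotonicity of a product. -/
lemma hasDerivAt_exp_log_weight (hκ : 0 < κ) (R : ℝ) {t : ℝ} (hw : 0 < weight κ t) :
    HasDerivAt (fun t => Real.exp (-(R / κ) * Real.log (weight κ t)))
      (Real.exp (-(R / κ) * Real.log (weight κ t)) * (R / weight κ t)) t := by
  have h1 := (((hasDerivAt_weight κ t).log hw.ne').const_mul (-(R / κ))).exp
  refine h1.congr_deriv ?_
  field_simp

lemma flux_deriv_le (hb : 0 < b) {w V y : ℝ} (hw : 0 < w) (hw1 : w ≤ 1) (hy : 0 ≤ y)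
    (hy1 : y ≤ 1) {R : ℝ} (hV : V ≤ R ^ 2) : (V - w / b * (1 - y ^ 2)) * y ≤ R ^ 2 * y / w := by
  have h1 : 0 ≤ w / b * (1 - y ^ 2) := by
    have : 0 ≤ 1 - y ^ 2 := by nlinarith
    positivity
  have h2 : (V - w / b * (1 - y ^ 2)) * y ≤ R ^ 2 * y := by gcongr; linarith
  refine h2.trans ?_
  rw [le_div_iff₀ hw]
  have : 0 ≤ R ^ 2 * y := by positivity
  nlinarith

/-- Upper bound on the logarithmic derivative, propagated from the left end point. -/
lemma flux_le (P : IsProfile b κ α T f h) (hb : 1 ≤ b) (hκ : 0 < κ) (hκT : κ * T ≤ 1 / 2)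
    (hT : 0 < T) {R c : ℝ} (hR : 0 ≤ R) (hc : c ≤ T)
    (hV : ∀ t ∈ Ioo 0 c, phase κ α t ^ 2 / weight κ t ≤ R ^ 2) :
    ∀ t ∈ Icc 0 c, h t ≤ R * f t := by
  have hsub := Icc_subset_Icc (le_refl (0 : ℝ)) hc
  have hpos : ∀ t ∈ Icc 0 c, 0 < weight κ t := fun t ht => by
    linarith [(weight_mem hκ.le hκT (hsub ht)).1]
  -- Since h' ≤ R² f / w, the product is non-increasing; it starts at a non-positive value because
  -- h(0) = 0.
  have hanti : AntitoneOn (fun t => (h t - R * f t) *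
      Real.exp (-(R / κ) * Real.log (weight κ t))) (Icc 0 c) := by
    refine antitoneOn_of_hasDerivWithinAt_nonpos (f' := fun t =>
      ((phase κ α t ^ 2 / weight κ t - weight κ t / b * (1 - f t ^ 2)) * f t
        - R * (h t / weight κ t)) * Real.exp (-(R / κ) * Real.log (weight κ t)) +
      (h t - R * f t) * (Real.exp (-(R / κ) * Real.log (weight κ t)) * (R / weight κ t)))
      (convex_Icc 0 c) ?_ ?_ ?_
    · refine ((P.continuousOn_flux.mono hsub).sub
        (continuousOn_const.mul (P.continuousOn.mono hsub))).mul ?_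
      exact fun t ht =>
        (hasDerivAt_exp_log_weight hκ R (hpos t ht)).continuousAt.continuousWithinAt
    · rw [interior_Icc]
      intro t ht
      have ht' : t ∈ Ioo 0 T := ⟨ht.1, ht.2.trans_le hc⟩
      exact (((P.hasDerivAt_flux t ht').sub ((P.hasDerivAt t ht').const_mul R)).mul
        (hasDerivAt_exp_log_weight hκ R (hpos t (Ioo_subset_Icc_self ht)))).hasDerivWithinAt
    · rw [interior_Icc]
      intro t ht
      have htT := hsub (Ioo_subset_Icc_self ht)
      have hw := hpos t (Ioo_subset_Icc_self ht)
      have h1 := flux_deriv_le (b := b) (by linarith) hw (weight_mem hκ.le hκT htT).2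
        (P.nonneg t htT) (P.le_one hb hκ.le hκT hT t htT) (hV t ht)
      have h2 := Real.exp_pos (-(R / κ) * Real.log (weight κ t))
      have h3 : ∀ E X : ℝ, (X - R * (h t / weight κ t)) * E +
          (h t - R * f t) * (E * (R / weight κ t)) = (X - R ^ 2 * f t / weight κ t) * E := by
        intro E X; field_simp; ring
      rw [h3]
      exact mul_nonpos_of_nonpos_of_nonneg (by linarith) h2.le
  intro t ht
  have h1 := hanti ⟨le_rfl, ht.1.trans ht.2⟩ ht ht.1
  simp only [P.flux_zero] at h1
  have h2 := Real.exp_pos (-(R / κ) * Real.log (weight κ t))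
  have h3 := Real.exp_pos (-(R / κ) * Real.log (weight κ 0))
  have h4 : 0 ≤ R * f 0 := mul_nonneg hR (P.nonneg 0 ⟨le_rfl, hT.le⟩)
  by_contra! hcon
  have h5 : 0 < (h t - R * f t) * Real.exp (-(R / κ) * Real.log (weight κ t)) :=
    mul_pos (by linarith) h2
  have h6 := mul_nonneg h4 h3.le
  nlinarith

/-- Lower bound on the logarithmic derivative, propagated from the right end point. -/
lemma neg_le_flux (P : IsProfile b κ α T f h) (hb : 1 ≤ b) (hκ : 0 < κ) (hκT : κ * T ≤ 1 / 2)
    (hT : 0 < T) {R a : ℝ} (hR : 0 ≤ R) (ha : 0 ≤ a)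
    (hV : ∀ t ∈ Ioo a T, phase κ α t ^ 2 / weight κ t ≤ R ^ 2) :
    ∀ t ∈ Icc a T, -(R * f t) ≤ h t := by
  have hsub := Icc_subset_Icc ha (le_refl T)
  have hpos : ∀ t ∈ Icc a T, 0 < weight κ t := fun t ht => by
    linarith [(weight_mem hκ.le hκT (hsub ht)).1]
  -- The same with R replaced by -R: the product is non-increasing and ends at a non-negative value
  -- because h(T) = 0.
  have hanti : AntitoneOn (fun t => (h t + R * f t) *
      Real.exp (-((-R) / κ) * Real.log (weight κ t))) (Icc a T) := by
    refine antitoneOn_of_hasDerivWithinAt_nonpos (f' := fun t =>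
      ((phase κ α t ^ 2 / weight κ t - weight κ t / b * (1 - f t ^ 2)) * f t
        + R * (h t / weight κ t)) * Real.exp (-((-R) / κ) * Real.log (weight κ t)) +
      (h t + R * f t) * (Real.exp (-((-R) / κ) * Real.log (weight κ t)) * ((-R) / weight κ t)))
      (convex_Icc a T) ?_ ?_ ?_
    · refine ((P.continuousOn_flux.mono hsub).add
        (continuousOn_const.mul (P.continuousOn.mono hsub))).mul ?_
      exact fun t ht =>
        (hasDerivAt_exp_log_weight hκ (-R) (hpos t ht)).continuousAt.continuousWithinAt
    · rw [interior_Icc]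
      intro t ht
      have ht' : t ∈ Ioo 0 T := ⟨ha.trans_lt ht.1, ht.2⟩
      exact (((P.hasDerivAt_flux t ht').add ((P.hasDerivAt t ht').const_mul R)).mul
        (hasDerivAt_exp_log_weight hκ (-R) (hpos t (Ioo_subset_Icc_self ht)))).hasDerivWithinAt
    · rw [interior_Icc]
      intro t ht
      have htT := hsub (Ioo_subset_Icc_self ht)
      have hw := hpos t (Ioo_subset_Icc_self ht)
      have h1 := flux_deriv_le (b := b) (by linarith) hw (weight_mem hκ.le hκT htT).2
        (P.nonneg t htT) (P.le_one hb hκ.le hκT hT t htT) (hV t ht)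
      have h2 := Real.exp_pos (-((-R) / κ) * Real.log (weight κ t))
      have h3 : ∀ E X : ℝ, (X + R * (h t / weight κ t)) * E +
          (h t + R * f t) * (E * ((-R) / weight κ t)) = (X - R ^ 2 * f t / weight κ t) * E := by
        intro E X; field_simp; ring
      rw [h3]
      exact mul_nonpos_of_nonpos_of_nonneg (by linarith) h2.le
  intro t ht
  have h1 := hanti ht ⟨ht.1.trans ht.2, le_rfl⟩ ht.2
  simp only [P.flux_end] at h1
  have h2 := Real.exp_pos (-((-R) / κ) * Real.log (weight κ t))
  have h3 := Real.exp_pos (-((-R) / κ) * Real.log (weight κ T))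
  have h4 : 0 ≤ R * f T := mul_nonneg hR (P.nonneg T ⟨hT.le, le_rfl⟩)
  by_contra! hcon
  have h5 : (h t + R * f t) * Real.exp (-((-R) / κ) * Real.log (weight κ t)) < 0 :=
    mul_neg_of_neg_of_pos (by linarith) h2
  have h6 := mul_nonneg h4 h3.le
  nlinarith

/-- The rate is 2R rather than R because f' = h / w and w ≥ 1/2. -/
lemma antitoneOn_mul_exp (P : IsProfile b κ α T f h) (hκ : 0 ≤ κ) (hκT : κ * T ≤ 1 / 2)
    {R a c : ℝ} (hR : 0 ≤ R) (ha : 0 ≤ a) (hc : c ≤ T) (hh : ∀ t ∈ Icc a c, h t ≤ R * f t) :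
    AntitoneOn (fun t => f t * Real.exp (-(2 * R) * t)) (Icc a c) := by
  refine antitoneOn_of_hasDerivWithinAt_nonpos (f' := fun t =>
    h t / weight κ t * Real.exp (-(2 * R) * t) + f t * (Real.exp (-(2 * R) * t) * (-(2 * R))))
    (convex_Icc a c) ?_ ?_ ?_
  · exact (P.continuousOn.mono (Icc_subset_Icc ha hc)).mul (by fun_prop)
  · rw [interior_Icc]
    intro t ht
    have h1 : HasDerivAt (fun t => Real.exp (-(2 * R) * t))
        (Real.exp (-(2 * R) * t) * (-(2 * R))) t := by
      simpa using ((hasDerivAt_id t).const_mul (-(2 * R))).exp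
    exact ((P.hasDerivAt t ⟨ha.trans_lt ht.1, ht.2.trans_le hc⟩).mul h1).hasDerivWithinAt
  · rw [interior_Icc]
    intro t ht
    have htT : t ∈ Icc 0 T := ⟨ha.trans ht.1.le, ht.2.le.trans hc⟩
    have hw := (weight_mem hκ hκT htT).1
    have h1 : h t / weight κ t ≤ 2 * R * f t := by
      rw [div_le_iff₀ (by linarith)]
      have h2 := mul_nonneg hR (P.nonneg t htT)
      nlinarith [hh t (Ioo_subset_Icc_self ht)]
    have h2 := Real.exp_pos (-(2 * R) * t)
    nlinarith

lemma monotoneOn_mul_exp (P : IsProfile b κ α T f h) (hκ : 0 ≤ κ) (hκT : κ * T ≤ 1 / 2)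
    {R a c : ℝ} (hR : 0 ≤ R) (ha : 0 ≤ a) (hc : c ≤ T) (hh : ∀ t ∈ Icc a c, -(R * f t) ≤ h t) :
    MonotoneOn (fun t => f t * Real.exp (2 * R * t)) (Icc a c) := by
  refine monotoneOn_of_hasDerivWithinAt_nonneg (f' := fun t =>
    h t / weight κ t * Real.exp (2 * R * t) + f t * (Real.exp (2 * R * t) * (2 * R)))
    (convex_Icc a c) ?_ ?_ ?_
  · exact (P.continuousOn.mono (Icc_subset_Icc ha hc)).mul (by fun_prop)
  · rw [interior_Icc]
    intro t ht
    have h1 : HasDerivAt (fun t => Real.exp (2 * R * t)) (Real.exp (2 * R * t) * (2 * R)) t := by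
      simpa using ((hasDerivAt_id t).const_mul (2 * R)).exp
    exact ((P.hasDerivAt t ⟨ha.trans_lt ht.1, ht.2.trans_le hc⟩).mul h1).hasDerivWithinAt
  · rw [interior_Icc]
    intro t ht
    have htT : t ∈ Icc 0 T := ⟨ha.trans ht.1.le, ht.2.le.trans hc⟩
    have hw := (weight_mem hκ hκT htT).1
    have h1 : -(2 * R * f t) ≤ h t / weight κ t := by
      rw [le_div_iff₀ (by linarith)]
      have h2 := mul_nonneg hR (P.nonneg t htT)
      nlinarith [hh t (Ioo_subset_Icc_self ht)]
    have h2 := Real.exp_pos (2 * R * t)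
    nlinarith

end IsProfile

/-! ### Harnack bounds -/

/-- The Harnack constant for phases of size at most `M` at an end point of the interval. -/
def harnackConst (M : ℝ) : ℝ := Real.exp (2 * (2 * (2 * M + 3)) * (2 * (M + 1)))

lemma one_le_harnackConst {M : ℝ} (hM : 0 ≤ M) : 1 ≤ harnackConst M :=
  Real.one_le_exp (by positivity)

lemma phase_sq_div_weight_le {M A w : ℝ} (hw : 1 / 2 ≤ w) (h1 : -(2 * M + 3) ≤ A)
    (h2 : A ≤ 2 * M + 3) : A ^ 2 / w ≤ (2 * (2 * M + 3)) ^ 2 := by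
  rw [div_le_iff₀ (by linarith)]
  have : A ^ 2 ≤ (2 * M + 3) ^ 2 := sq_le_sq' h1 h2
  nlinarith [sq_nonneg (2 * M + 3)]

namespace IsProfile

/-- If the phase starts in `[-M, 1]`, later values of the profile are controlled by earlier ones. -/
lemma le_harnackConst_mul (P : IsProfile b κ α T f h) (hb : 1 ≤ b) (hκ : 0 < κ)
    (hκT : κ * T ≤ 1 / 2) (hT : 0 < T) {M : ℝ} (hM : 0 ≤ M) (hα : -M ≤ α) (hα1 : α ≤ 1)
    {s t : ℝ} (hs : 0 ≤ s) (hst : s ≤ t) (ht : t ≤ T) : f t ≤ harnackConst M * f s := by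
  set R := 2 * (2 * M + 3) with hR
  have hR0 : 0 ≤ R := by positivity
  -- Up to c the phase has absolute value at most 2M + 3, and w ≥ 1/2, so A² / w ≤ R² and f grows at
  -- most exponentially. Beyond 2(M + 1) the phase is at least -M + (M + 1) = 1, so the flux is
  -- non-decreasing up to its zero at T and f is non-increasing.
  set c := min T (2 * (M + 1)) with hc
  have hcT : c ≤ T := min_le_left _ _
  have hcM : c ≤ 2 * (M + 1) := min_le_right _ _
  have hc0 : 0 ≤ c := le_min hT.le (by positivity)
  have hflux := P.flux_le hb hκ hκT hT hR0 hcT fun t ht => by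
    have h1 := phase_sub_mem (α := α) hκ.le hκT le_rfl ht.1.le (ht.2.le.trans hcT)
    rw [phase_zero] at h1
    exact phase_sq_div_weight_le (weight_mem hκ.le hκT ⟨ht.1.le, ht.2.le.trans hcT⟩).1
      (by linarith [h1.1, ht.1]) (by linarith [h1.2, ht.2])
  have hexp := P.antitoneOn_mul_exp hκ.le hκT hR0 le_rfl hcT hflux
  have hgrow : ∀ s t, 0 ≤ s → s ≤ t → t ≤ c → f t ≤ harnackConst M * f s := by
    intro s t hs hst htc
    have h1 := hexp ⟨hs, hst.trans htc⟩ ⟨hs.trans hst, htc⟩ hst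
    have h2 : f t ≤ f s * Real.exp (2 * R * (t - s)) := by
      have h3 : Real.exp (2 * R * (t - s)) =
          Real.exp (-(2 * R) * s) * Real.exp (2 * R * t) := by
        rw [← Real.exp_add]; ring_nf
      have h4 : Real.exp (-(2 * R) * t) * Real.exp (2 * R * t) = 1 := by
        rw [← Real.exp_add]; simp
      have h5 := mul_le_mul_of_nonneg_right h1 (Real.exp_pos (2 * R * t)).le
      beta_reduce at h5
      rwa [mul_assoc (f t), mul_assoc (f s), h4, mul_one, ← h3] at h5
    refine h2.trans ?_
    rw [mul_comm]
    refine mul_le_mul_of_nonneg_right ?_ (P.nonneg s ⟨hs, hst.trans (htc.trans hcT)⟩)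
    unfold harnackConst
    apply Real.exp_le_exp.2
    apply mul_le_mul_of_nonneg_left _ (by positivity)
    linarith
  have hanti : AntitoneOn f (Icc c T) := by
    have hmono := P.flux_monotoneOn hb hκ.le hκT hc0 le_rfl fun t ht => by
      have hct : 2 * (M + 1) ≤ t := by
        rcases min_choice T (2 * (M + 1)) with h1 | h1
        · rw [← hc] at h1; linarith [ht.1, ht.2]
        · rw [← hc] at h1; linarith [ht.1]
      have h1 := (phase_sub_mem (α := α) hκ.le hκT le_rfl (hc0.trans ht.1.le) ht.2.le).1
      rw [phase_zero] at h1
      have : 1 ≤ phase κ α t := by linarith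
      nlinarith
    refine P.antitoneOn_of_flux_nonpos hκ.le hκT hc0 le_rfl fun t ht => ?_
    have := hmono (Ioo_subset_Icc_self ht) ⟨hcT, le_rfl⟩ ht.2.le
    rwa [P.flux_end] at this
  have hD := one_le_harnackConst hM
  rcases le_total t c with h1 | h1
  · exact hgrow s t hs hst h1
  rcases le_total s c with h2 | h2
  · exact (hanti ⟨le_rfl, hcT⟩ ⟨h1, ht⟩ h1).trans (hgrow s c hs h2 le_rfl)
  · have h3 := hanti ⟨h2, hst.trans ht⟩ ⟨h1, ht⟩ hst
    have h4 := P.nonneg s ⟨hs, hst.trans ht⟩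
    nlinarith

/-- If the phase ends below `M`, the profile is controlled by its value at the right end point. -/
lemma le_harnackConst_mul_end (P : IsProfile b κ α T f h) (hb : 1 ≤ b) (hκ : 0 < κ)
    (hκT : κ * T ≤ 1 / 2) (hT : 0 < T) {M : ℝ} (hM : 0 ≤ M) (hA : phase κ α T ≤ M) :
    ∀ t ∈ Icc 0 T, f t ≤ harnackConst M * f T := by
  have hD := one_le_harnackConst hM
  have hfT := P.nonneg T ⟨hT.le, le_rfl⟩
  have hmonoOf : ∀ a ≤ T, 0 ≤ a → (∀ t ∈ Ioo 0 a, phase κ α t ≤ -1) → MonotoneOn f (Icc 0 a) := by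
    intro a haT ha hph
    have hmono := P.flux_monotoneOn hb hκ.le hκT le_rfl haT fun t ht => by
      nlinarith [hph t ht]
    refine P.monotoneOn_of_flux_nonneg hκ.le hκT le_rfl haT fun t ht => ?_
    have := hmono ⟨le_rfl, ha⟩ (Ioo_subset_Icc_self ht) ht.1.le
    rwa [P.flux_zero] at this
  intro t ht
  rcases le_total (phase κ α T) (-1) with hneg | hneg
  · have hmono := hmonoOf T le_rfl hT.le fun t ht => by
      have := (phase_sub_mem (α := α) hκ.le hκT ht.1.le ht.2.le le_rfl).1
      linarith [ht.2]
    have := hmono ht ⟨hT.le, le_rfl⟩ ht.2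
    nlinarith
  set R := 2 * (2 * M + 3) with hR
  have hR0 : 0 ≤ R := by positivity
  -- Mirror image of the argument from the left: on [a, T] the phase stays between -(2M + 3) and M,
  -- while to the left of T - 2(M + 1) it is at most -1 and f is non-decreasing.
  set a := max 0 (T - 2 * (M + 1)) with ha
  have ha0 : 0 ≤ a := le_max_left _ _
  have haM : T - 2 * (M + 1) ≤ a := le_max_right _ _
  have haT : a ≤ T := max_le hT.le (by linarith)
  have hflux := P.neg_le_flux hb hκ hκT hT hR0 ha0 fun t ht => by
    have h1 := phase_sub_mem (α := α) hκ.le hκT (ha0.trans ht.1.le) ht.2.le le_rfl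
    exact phase_sq_div_weight_le (weight_mem hκ.le hκT ⟨ha0.trans ht.1.le, ht.2.le⟩).1
      (by linarith [h1.2, ht.1]) (by linarith [h1.1, ht.2])
  have hexp := P.monotoneOn_mul_exp hκ.le hκT hR0 ha0 le_rfl hflux
  have hgrow : ∀ t ∈ Icc a T, f t ≤ harnackConst M * f T := by
    intro t ht
    have h1 := hexp ht ⟨haT, le_rfl⟩ ht.2
    have h2 : f t ≤ f T * Real.exp (2 * R * (T - t)) := by
      have h3 : Real.exp (2 * R * (T - t)) =
          Real.exp (2 * R * T) * Real.exp (-(2 * R * t)) := by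
        rw [← Real.exp_add]; ring_nf
      have h4 : Real.exp (2 * R * t) * Real.exp (-(2 * R * t)) = 1 := by
        rw [← Real.exp_add]; simp
      have h5 := mul_le_mul_of_nonneg_right h1 (Real.exp_pos (-(2 * R * t))).le
      rw [h3, ← mul_assoc]
      simpa [mul_assoc (f t), h4] using h5
    refine h2.trans ?_
    rw [mul_comm]
    refine mul_le_mul_of_nonneg_right ?_ hfT
    unfold harnackConst
    apply Real.exp_le_exp.2
    apply mul_le_mul_of_nonneg_left _ (by positivity)
    linarith [ht.1]
  rcases le_total a t with h1 | h1
  · exact hgrow t ⟨h1, ht.2⟩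
  · have hmono := hmonoOf a haT ha0 fun s hs => by
      have has : a = T - 2 * (M + 1) := by
        rcases max_choice 0 (T - 2 * (M + 1)) with h2 | h2
        · rw [← ha] at h2; linarith [hs.1, hs.2]
        · exact h2
      have := (phase_sub_mem (α := α) hκ.le hκT hs.1.le (hs.2.le.trans haT) le_rfl).1
      linarith [hs.2]
    exact (hmono ⟨ht.1, h1⟩ ⟨ha0, le_rfl⟩ h1).trans (hgrow a ⟨le_rfl, haT⟩)

end IsProfile

end Profile

/-! ### Comparison with a Gaussian when the well is far from both ends -/

section Gaussian

variable {b κ α T : ℝ} {f h : ℝ → ℝ}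

/-- The Wronskian of the profile and the Gaussian `exp (-A² / 2)`, `A` being the phase. -/
def gaussWronskian (κ α : ℝ) (f h : ℝ → ℝ) (t : ℝ) : ℝ :=
  (h t + f t * (phase κ α t * weight κ t ^ 2)) * Real.exp (-(phase κ α t ^ 2 / 2))

/-- The threshold 1024 / δ comes from exp(u) ≥ u² / 2 with u = x/4 - 1/8 ≥ x/8, so that the right
side is at least δ x² / 1024. -/
lemma le_mul_exp_of_large {δ x : ℝ} (hδ : 0 < δ) (hx1 : 1 ≤ x) (hx : 1024 / δ ≤ x) :
    x ≤ δ / 8 * Real.exp (x / 4 - 1 / 8) := by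
  have h1 : (x / 4 - 1 / 8) ^ 2 / 2 ≤ Real.exp (x / 4 - 1 / 8) := by
    have := Real.quadratic_le_exp_of_nonneg (show 0 ≤ x / 4 - 1 / 8 by linarith)
    linarith
  have h2 : x ^ 2 / 128 ≤ (x / 4 - 1 / 8) ^ 2 / 2 := by nlinarith
  have h3 : 1024 ≤ δ * x := by rw [div_le_iff₀ hδ] at hx; linarith
  have h4 : x ≤ δ / 8 * (x ^ 2 / 128) := by nlinarith
  exact h4.trans (mul_le_mul_of_nonneg_left (h2.trans h1) (by positivity))

lemma gaussian_le_of_abs_le {x y : ℝ} (hy : |y| ≤ x - 1 / 4) :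
    Real.exp (-(x ^ 2 / 2)) * Real.exp (x / 4 - 1 / 8) ≤ Real.exp (-(y ^ 2 / 2)) := by
  rw [← Real.exp_add]
  apply Real.exp_le_exp.2
  have h1 : y ^ 2 ≤ (x - 1 / 4) ^ 2 := sq_le_sq' (by linarith [(abs_le.1 hy).1]) (abs_le.1 hy).2
  nlinarith

namespace IsProfile

/-- For κ = 0 the first factor is 1 - (1 - f²)/b: the Gaussian has energy 1 and the A² terms cancel.
-/
lemma hasDerivAt_gaussWronskian (P : IsProfile b κ α T f h) {t : ℝ} (ht : t ∈ Ioo 0 T)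
    (hw : weight κ t ≠ 0) : HasDerivAt (gaussWronskian κ α f h)
      ((phase κ α t ^ 2 / weight κ t - weight κ t / b * (1 - f t ^ 2) + weight κ t ^ 3
        - 2 * κ * phase κ α t * weight κ t - phase κ α t ^ 2 * weight κ t ^ 3) *
        (f t * Real.exp (-(phase κ α t ^ 2 / 2)))) t := by
  have hA := hasDerivAt_phase κ α t
  have h1 := ((hA.pow 2).div_const 2).neg.exp
  have h2 := ((P.hasDerivAt_flux t ht).add ((P.hasDerivAt t ht).mul
    (hA.mul ((hasDerivAt_weight κ t).pow 2)))).mul h1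
  refine h2.congr_deriv ?_
  simp
  field_simp
  ring

/-- The leftover potential A²/w - A²w³ is non-negative, and κA ≤ κT keeps the other curvature terms
below half of 1 - 1/b; the last factor 1/2 in the rate (1 - 1/b)/4 is the lower bound on w. The
choice C = 0 gives plain monotonicity. -/
lemma gaussWronskian_increase (P : IsProfile b κ α T f h) (hb : 1 < b) (hκ : 0 ≤ κ)
    (hκT : κ * T ≤ 1 / 2) (hsmall : 8 * (κ * T) ≤ 1 - 1 / b)
    (hph : ∀ t ∈ Icc 0 T, phase κ α t ≤ T) {C a c : ℝ} (ha : 0 ≤ a) (hac : a ≤ c) (hc : c ≤ T)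
    (hC : ∀ t ∈ Ioo a c, C ≤ (1 - 1 / b) / 4 * (f t * Real.exp (-(phase κ α t ^ 2 / 2)))) :
    C * (c - a) ≤ gaussWronskian κ α f h c - gaussWronskian κ α f h a := by
  have hsub := Icc_subset_Icc ha hc
  have hmono : MonotoneOn (fun t => gaussWronskian κ α f h t - C * t) (Icc a c) := by
    refine monotoneOn_of_hasDerivWithinAt_nonneg (f' := fun t =>
      (phase κ α t ^ 2 / weight κ t - weight κ t / b * (1 - f t ^ 2) + weight κ t ^ 3
        - 2 * κ * phase κ α t * weight κ t - phase κ α t ^ 2 * weight κ t ^ 3) *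
        (f t * Real.exp (-(phase κ α t ^ 2 / 2))) - C * 1) (convex_Icc a c) ?_ ?_ ?_
    · have hwc := continuous_weight κ
      have hpc := continuous_phase κ α
      have h1 := P.continuousOn.mono hsub
      have h2 := P.continuousOn_flux.mono hsub
      unfold gaussWronskian
      fun_prop
    · rw [interior_Icc]
      intro t ht
      have ht' : t ∈ Ioo 0 T := ⟨ha.trans_lt ht.1, ht.2.trans_le hc⟩
      have hw := (weight_mem hκ hκT (Ioo_subset_Icc_self ht')).1
      exact ((P.hasDerivAt_gaussWronskian ht' (by linarith)).sub
        ((hasDerivAt_id t).const_mul C)).hasDerivWithinAt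
    · rw [interior_Icc]
      intro t ht
      have htT := hsub (Ioo_subset_Icc_self ht)
      obtain ⟨w1, w2⟩ := weight_mem hκ hκT htT
      have hf := P.nonneg t htT
      have hw := sub_nonneg.2 w2
      set w := weight κ t with hwdef
      set A := phase κ α t with hA
      have hwT : 1 - κ * T ≤ w := by
        have := mul_le_mul_of_nonneg_left htT.2 hκ
        rw [hwdef]; unfold weight; linarith
      have h1 : A ^ 2 * w ^ 3 ≤ A ^ 2 / w := by
        rw [le_div_iff₀ (by linarith), mul_assoc, ← pow_succ]
        exact mul_le_of_le_one_right (sq_nonneg A) (pow_le_one₀ (by linarith) w2)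
      have h2 : κ * A ≤ κ * T := mul_le_mul_of_nonneg_left (hph t htT) hκ
      have h3 : (1 - 1 / b) / 2 ≤ w ^ 2 - 1 / b - 2 * (κ * A) := by nlinarith
      have hδ : 0 < 1 - 1 / b := by
        have : 1 / b < 1 := by rw [div_lt_one (by linarith)]; exact hb
        linarith
      have h4 : (1 - 1 / b) / 4 ≤ w * (w ^ 2 - 1 / b - 2 * (κ * A)) := by nlinarith
      have h5 : 0 ≤ w / b * f t ^ 2 := by positivity
      have h6 : (1 - 1 / b) / 4 ≤ A ^ 2 / w - w / b * (1 - f t ^ 2) + w ^ 3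
          - 2 * κ * A * w - A ^ 2 * w ^ 3 := by
        have h7 : w * (w ^ 2 - 1 / b - 2 * (κ * A)) = w ^ 3 - w / b - 2 * κ * A * w := by ring
        rw [h7] at h4
        linarith
      have h8 : 0 ≤ f t * Real.exp (-(A ^ 2 / 2)) := by positivity
      have h9 := mul_le_mul_of_nonneg_right h6 h8
      have h10 := hC t ht
      linarith
  have := hmono ⟨le_rfl, hac⟩ ⟨hac, le_rfl⟩ hac
  simp only at this
  linarith

/-- There is no non-trivial profile when the phase is large at both end points: the potential
well sits far from the boundary and the full-line ground state energy `1` exceeds `1 / b`. -/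
lemma eq_zero_of_phase_large (P : IsProfile b κ α T f h) (hb : 1 < b) (hκ : 0 ≤ κ)
    (hκT : κ * T ≤ 1 / 2) (hT : 0 < T) (hsmall : 8 * (κ * T) ≤ 1 - 1 / b)
    (hα : α ≤ -(1024 / (1 - 1 / b))) (hA : 1024 / (1 - 1 / b) ≤ phase κ α T) :
    ∀ t ∈ Icc 0 T, f t = 0 := by
  set δ := 1 - 1 / b with hδdef
  have hb0 : 0 < 1 / b := by positivity
  have hδ : 0 < δ := by
    have : 1 / b < 1 := by rw [div_lt_one (by linarith)]; exact hb
    linarith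
  set M := 1024 / δ with hM
  have hM1 : 1024 ≤ M := by
    rw [hM, le_div_iff₀ hδ]; linarith
  have hTA := phase_sub_mem (α := α) hκ hκT le_rfl hT.le le_rfl
  rw [phase_zero] at hTA
  have hT2 : 2048 ≤ T := by linarith [hTA.2]
  have hph : ∀ t ∈ Icc 0 T, phase κ α t ≤ T := by
    intro t ht
    have := (phase_sub_mem (α := α) hκ hκT le_rfl ht.1 ht.2).2
    rw [phase_zero] at this
    linarith [ht.2]
  have hinc : ∀ a c, 0 ≤ a → a ≤ c → c ≤ T →
      gaussWronskian κ α f h a ≤ gaussWronskian κ α f h c := by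
    intro a c ha hac hc
    have := P.gaussWronskian_increase hb hκ hκT hsmall hph (C := 0) ha hac hc fun t ht => by
      have := P.nonneg t ⟨ha.trans ht.1.le, ht.2.le.trans hc⟩
      positivity
    linarith
  -- The length 3/2 makes the two end intervals overlap (1, T - 1), where f is shown to vanish;
  -- monotonicity then carries the zero to the ends.
  have hmono : MonotoneOn f (Icc 0 (3 / 2)) := by
    have h1 := P.flux_monotoneOn hb.le hκ hκT le_rfl (c := 3 / 2) (by linarith) fun t ht => by
      have := (phase_sub_mem (α := α) hκ hκT le_rfl ht.1.le (by linarith [ht.2])).2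
      rw [phase_zero] at this
      nlinarith [ht.2]
    refine P.monotoneOn_of_flux_nonneg hκ hκT le_rfl (by linarith) fun t ht => ?_
    have := h1 ⟨le_rfl, by norm_num⟩ (Ioo_subset_Icc_self ht) ht.1.le
    rwa [P.flux_zero] at this
  have hanti : AntitoneOn f (Icc (T - 3 / 2) T) := by
    have h1 := P.flux_monotoneOn hb.le hκ hκT (a := T - 3 / 2) (by linarith) le_rfl fun t ht => by
      have := (phase_sub_mem (α := α) hκ hκT (by linarith [ht.1]) ht.2.le le_rfl).2
      nlinarith [ht.1]
    refine P.antitoneOn_of_flux_nonpos hκ hκT (by linarith) le_rfl fun t ht => ?_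
    have := h1 (Ioo_subset_Icc_self ht) ⟨by linarith, le_rfl⟩ ht.2.le
    rwa [P.flux_end] at this
  have hf0 := P.nonneg 0 ⟨le_rfl, hT.le⟩
  have hfT := P.nonneg T ⟨hT.le, le_rfl⟩
  -- The Wronskian starts at the negative value α f(0) exp(-α²/2). On [1/2, 1] the phase has moved
  -- by at least 1/4 towards 0, so the Gaussian is larger by a factor exponential in |α|, and the
  -- gain over this interval outweighs the deficit.
  have hleft : 0 ≤ gaussWronskian κ α f h 1 := by
    have h1 := P.gaussWronskian_increase hb hκ hκT hsmall hph (a := 1 / 2) (c := 1)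
      (C := δ / 4 * (f 0 * (Real.exp (-(α ^ 2 / 2)) * Real.exp (-α / 4 - 1 / 8))))
      (by norm_num) (by norm_num) (by linarith) fun t ht => by
        have hp := phase_sub_mem (α := α) hκ hκT le_rfl (show 0 ≤ t by linarith [ht.1])
          (by linarith [ht.2])
        rw [phase_zero] at hp
        have h2 := gaussian_le_of_abs_le (x := -α) (y := phase κ α t) (by
          rw [abs_le]; constructor <;> linarith [hp.1, hp.2, ht.1, ht.2])
        rw [neg_sq] at h2
        have h3 : f 0 ≤ f t := hmono ⟨le_rfl, by norm_num⟩
          ⟨by linarith [ht.1], by linarith [ht.2]⟩ (by linarith [ht.1])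
        gcongr
        exact hf0.trans h3
    have h2 := hinc 0 (1 / 2) le_rfl (by norm_num) (by linarith)
    have h3 : gaussWronskian κ α f h 0 = f 0 * α * Real.exp (-(α ^ 2 / 2)) := by
      simp [gaussWronskian, P.flux_zero, phase_zero, weight]
    have h4 := le_mul_exp_of_large hδ (show 1 ≤ -α by linarith) (by linarith)
    have h5 : 0 ≤ f 0 * Real.exp (-(α ^ 2 / 2)) := by positivity
    have h6 := mul_le_mul_of_nonneg_right h4 h5
    rw [h3] at h2
    linarith
  have hright : gaussWronskian κ α f h (T - 1) ≤ 0 := by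
    set x := phase κ α T with hx
    have h1 := P.gaussWronskian_increase hb hκ hκT hsmall hph (a := T - 1) (c := T - 1 / 2)
      (C := δ / 4 * (f T * (Real.exp (-(x ^ 2 / 2)) * Real.exp (x / 4 - 1 / 8))))
      (by linarith) (by linarith) (by linarith) fun t ht => by
        have hp := phase_sub_mem (α := α) hκ hκT (show 0 ≤ t by linarith [ht.1])
          (by linarith [ht.2]) (le_refl T)
        have h2 := gaussian_le_of_abs_le (x := x) (y := phase κ α t) (by
          rw [abs_le]; constructor <;> linarith [hp.1, hp.2, ht.1, ht.2])
        have h3 : f T ≤ f t := hanti ⟨by linarith [ht.1], by linarith [ht.2]⟩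
          ⟨by linarith, le_rfl⟩ (by linarith [ht.2])
        gcongr
        exact hfT.trans h3
    have h2 := hinc (T - 1 / 2) T (by linarith) (by linarith) le_rfl
    have h3 : gaussWronskian κ α f h T ≤ x * (f T * Real.exp (-(x ^ 2 / 2))) := by
      obtain ⟨w1, w2⟩ := weight_mem hκ hκT (t := T) ⟨hT.le, le_rfl⟩
      have hw : weight κ T ^ 2 ≤ 1 := pow_le_one₀ (by linarith) w2
      have h4 : 0 ≤ x * (f T * Real.exp (-(x ^ 2 / 2))) := by
        have : 0 ≤ x := by linarith
        positivity
      have h5 := mul_le_mul_of_nonneg_left hw h4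
      simp only [gaussWronskian, P.flux_end, ← hx]
      linarith
    have h4 := le_mul_exp_of_large hδ (show 1 ≤ x by linarith) hA
    have h5 : 0 ≤ f T * Real.exp (-(x ^ 2 / 2)) := by positivity
    have h6 := mul_le_mul_of_nonneg_right h4 h5
    linarith
  -- The Wronskian is non-decreasing, non-negative at 1 and non-positive at T - 1, hence zero in
  -- between; a positive value of f there would make it increase.
  have hmid : ∀ t ∈ Ioo 1 (T - 1), f t = 0 := by
    intro t ht
    have ht' : t ∈ Ioo 0 T := ⟨by linarith [ht.1], by linarith [ht.2]⟩
    have hconst : ∀ s ∈ Icc 1 (T - 1), gaussWronskian κ α f h s = 0 := by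
      intro s hs
      have h1 := hinc 1 s (by norm_num) hs.1 (by linarith [hs.2])
      have h2 := hinc s (T - 1) (by linarith [hs.1]) hs.2 (by linarith)
      linarith
    have hft := P.nonneg t (Ioo_subset_Icc_self ht')
    by_contra hne
    have hpos : 0 < f t := lt_of_le_of_ne hft (Ne.symm hne)
    have hcont : ContinuousAt (fun s => δ / 4 * (f s * Real.exp (-(phase κ α s ^ 2 / 2)))) t := by
      have h1 := P.continuousOn.continuousAt (Icc_mem_nhds ht'.1 ht'.2)
      have h2 := continuous_phase κ α
      fun_prop
    set C := δ / 4 * (f t * Real.exp (-(phase κ α t ^ 2 / 2))) with hC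
    have hC0 : 0 < C := by positivity
    have hev := hcont.eventually (lt_mem_nhds (half_lt_self hC0))
    rw [Metric.eventually_nhds_iff] at hev
    obtain ⟨r, hr, hev⟩ := hev
    obtain ⟨c, hc1, hc2⟩ : ∃ c, t < c ∧ c < min (T - 1) (t + r) :=
      exists_between (lt_min ht.2 (by linarith))
    have hcT := hc2.trans_le (min_le_left _ _)
    have hcr := hc2.trans_le (min_le_right _ _)
    have h1 := P.gaussWronskian_increase hb hκ hκT hsmall hph (C := C / 2) ht'.1.le hc1.le
      (by linarith) fun s hs => (hev (by
        rw [Real.dist_eq, abs_lt]; constructor <;> linarith [hs.1, hs.2])).le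
    rw [hconst t (Ioo_subset_Icc_self ht), hconst c ⟨by linarith [ht.1], hcT.le⟩] at h1
    nlinarith
  intro t ht
  have hft := P.nonneg t ht
  rcases le_or_gt t (3 / 2) with h1 | h1
  · have h2 := hmono ⟨ht.1, h1⟩ ⟨by norm_num, le_rfl⟩ h1
    rw [hmid (3 / 2) ⟨by norm_num, by linarith⟩] at h2
    linarith
  rcases le_or_gt (T - 3 / 2) t with h2 | h2
  · have h3 := hanti ⟨le_rfl, by linarith⟩ ⟨h2, ht.2⟩ h2
    rw [hmid (T - 3 / 2) ⟨by linarith, by linarith⟩] at h3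
    linarith
  · exact hmid t ⟨by linarith, by linarith⟩

end IsProfile

end Gaussian

/-! ### Lower bound on the cost function through the first integral -/

section Cost

variable {b κ α T : ℝ} {f h : ℝ → ℝ}

/-- The primitive of `2 A f² / (1 - κ t)` given by the flat first integral of the profile
equation, up to curvature terms. -/
def firstIntegral (b κ α : ℝ) (f h : ℝ → ℝ) (t : ℝ) : ℝ :=
  -(h t / weight κ t) ^ 2 + phase κ α t ^ 2 / weight κ t ^ 2 * f t ^ 2
    - 1 / b * (f t ^ 2 - f t ^ 4 / 2)

lemma one_sub_inv_sq_ge {d : ℝ} (hd : 0 ≤ d) (hd2 : d ≤ 1 / 2) :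
    -(6 * d) ≤ 1 - 1 / (1 - d) ^ 2 := by
  have h1 : 1 / (1 - d) ^ 2 ≤ 1 + 6 * d := by
    rw [div_le_iff₀ (by nlinarith)]
    nlinarith [mul_nonneg hd (sub_nonneg.2 hd2), mul_nonneg hd (mul_nonneg hd hd)]
  linarith

lemma sq_div_sq_le {A w S : ℝ} (hw : 1 / 2 ≤ w) (hA : |A| ≤ S) : A ^ 2 / w ^ 2 ≤ 4 * S ^ 2 := by
  have hw0 : 0 < w := by linarith
  rw [div_le_iff₀ (by positivity)]
  have h3 := sq_le_sq' (abs_le.1 hA).1 (abs_le.1 hA).2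
  have h4 : 1 ≤ 4 * w ^ 2 := by nlinarith
  nlinarith [sq_nonneg S]

/-- At a critical point of the cost function the potential almost compensates the kinetic term. -/
lemma potential_sub_kinetic_ge {A w y d S p : ℝ} (hw : 1 / 2 ≤ w) (hd : 0 ≤ d)
    (hd2 : d ≤ 1 / 2) (hA : |A| ≤ S) (hp : (1 - d) * p = -(A * y)) :
    -(24 * S ^ 2 * d) * y ^ 2 ≤ -(p / w) ^ 2 + A ^ 2 / w ^ 2 * y ^ 2 ∧
      -(2 * S * y ^ 2) ≤ p * y := by
  have hw0 : 0 < w := by linarith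
  have hd1 : 0 < 1 - d := by linarith
  have hh : p = -(A * y) / (1 - d) := by rw [eq_div_iff hd1.ne']; linarith
  have hS0 : 0 ≤ S := (abs_nonneg _).trans hA
  constructor
  · have hfluxsq : -(p / w) ^ 2 + A ^ 2 / w ^ 2 * y ^ 2 =
        A ^ 2 / w ^ 2 * (1 - 1 / (1 - d) ^ 2) * y ^ 2 := by
      rw [hh]; field_simp; ring
    rw [hfluxsq]
    refine mul_le_mul_of_nonneg_right ?_ (sq_nonneg y)
    have h3 : 0 ≤ A ^ 2 / w ^ 2 := by positivity
    have h4 := mul_le_mul_of_nonneg_left (one_sub_inv_sq_ge hd hd2) h3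
    have h5 := mul_le_mul_of_nonneg_right (sq_div_sq_le hw hA) (show 0 ≤ 6 * d by linarith)
    linarith
  · have h2 : p * y = -(A / (1 - d)) * y ^ 2 := by rw [hh]; ring
    have h3 : A / (1 - d) ≤ 2 * S := by
      rw [div_le_iff₀ hd1]
      nlinarith [(abs_le.1 hA).2]
    rw [h2]
    nlinarith [sq_nonneg y]

namespace IsProfile

/-- Multiplying the equation by 2 f' makes all flat terms cancel except 2 A f² / w, which is F'; the
remainder carries a factor κ. -/
lemma hasDerivAt_firstIntegral (P : IsProfile b κ α T f h) {t : ℝ} (ht : t ∈ Ioo 0 T)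
    (hw : weight κ t ≠ 0) : HasDerivAt (firstIntegral b κ α f h)
      (2 * (phase κ α t / weight κ t * f t ^ 2) + 2 * κ / weight κ t *
        (phase κ α t ^ 2 * f t ^ 2 - h t ^ 2) / weight κ t ^ 2) t := by
  have hA := hasDerivAt_phase κ α t
  have hW := hasDerivAt_weight κ t
  have hf := P.hasDerivAt t ht
  have h1 := ((((P.hasDerivAt_flux t ht).div hW hw).pow 2).neg.add
    (((hA.pow 2).div (hW.pow 2) (pow_ne_zero 2 hw)).mul (hf.pow 2))).sub
    (((hf.pow 2).sub ((hf.pow 4).div_const 2)).const_mul (1 / b))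
  refine h1.congr_deriv ?_
  simp
  by_cases hb : b = 0
  · subst hb; simp; field_simp; ring
  · field_simp; ring

lemma continuousOn_firstIntegral (P : IsProfile b κ α T f h)
    (hw : ∀ t ∈ Icc 0 T, weight κ t ≠ 0) :
    ContinuousOn (firstIntegral b κ α f h) (Icc 0 T) := by
  have hwc := (continuous_weight κ).continuousOn (s := Icc 0 T)
  have hV : ContinuousOn (fun t => phase κ α t ^ 2 / weight κ t ^ 2) (Icc 0 T) :=
    ((continuous_phase κ α).pow 2).continuousOn.div (hwc.pow 2) fun t ht => pow_ne_zero 2 (hw t ht)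
  have hhw : ContinuousOn (fun t => h t / weight κ t) (Icc 0 T) := P.continuousOn_flux.div hwc hw
  have hf := P.continuousOn
  unfold firstIntegral
  fun_prop

/-- Comparison of a primitive `F` of `2 A f² / (1 - κ t)` with the first integral, when the profile
is bounded on `[s, T]` by a multiple of its value at `s`. -/
lemma firstIntegral_le_of_primitive (P : IsProfile b κ α T f h) (hb : 1 ≤ b) (hκ : 0 ≤ κ)
    (hκT : κ * T ≤ 1 / 2) (hT : 0 < T) {F : ℝ → ℝ} (hFc : ContinuousOn F (Icc 0 T))
    (hF' : ∀ t ∈ Ioo 0 T, HasDerivAt F (2 * (phase κ α t / weight κ t * f t ^ 2)) t)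
    {s B : ℝ} (hs : s ∈ Icc 0 T) (hB : ∀ t ∈ Icc s T, f t ^ 2 ≤ B) :
    F T - firstIntegral b κ α f h T + firstIntegral b κ α f h s
      + 8 * κ * (h s * f s) - 8 * κ * B * (T - s) ≤ F s := by
  have hsub := Icc_subset_Icc hs.1 (le_refl T)
  have hw : ∀ t ∈ Icc 0 T, weight κ t ≠ 0 := fun t ht => by
    have := (weight_mem hκ hκT ht).1
    linarith
  -- The corrector 8κ h f has h² / w in its derivative, which absorbs the only curvature term of the
  -- wrong sign, so no pointwise bound on h is needed. The linear part 8κ B t absorbs the nonlinear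
  -- term that the corrector brings in.
  have hanti : AntitoneOn (fun t => F t - firstIntegral b κ α f h t
      - 8 * κ * (h t * f t + B * t)) (Icc s T) := by
    refine antitoneOn_of_hasDerivWithinAt_nonpos (f' := fun t =>
      2 * (phase κ α t / weight κ t * f t ^ 2) -
      (2 * (phase κ α t / weight κ t * f t ^ 2) + 2 * κ / weight κ t *
        (phase κ α t ^ 2 * f t ^ 2 - h t ^ 2) / weight κ t ^ 2) -
      8 * κ * (((phase κ α t ^ 2 / weight κ t - weight κ t / b * (1 - f t ^ 2)) * f t) * f t +
        h t * (h t / weight κ t) + B * 1)) (convex_Icc s T) ?_ ?_ ?_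
    · have h1 := (P.continuousOn_firstIntegral hw).mono hsub
      have h2 := hFc.mono hsub
      have h3 := P.continuousOn.mono hsub
      have h4 := P.continuousOn_flux.mono hsub
      fun_prop
    · rw [interior_Icc]
      intro t ht
      have ht' : t ∈ Ioo 0 T := ⟨hs.1.trans_lt ht.1, ht.2⟩
      exact (((hF' t ht').sub
        (P.hasDerivAt_firstIntegral ht' (hw t (Ioo_subset_Icc_self ht')))).sub
        ((((P.hasDerivAt_flux t ht').mul (P.hasDerivAt t ht')).add
          ((hasDerivAt_id t).const_mul B)).const_mul (8 * κ))).hasDerivWithinAt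
    · rw [interior_Icc]
      intro t ht
      have htT := hsub (Ioo_subset_Icc_self ht)
      obtain ⟨w1, w2⟩ := weight_mem hκ hκT htT
      have hf := P.nonneg t htT
      have hf1 := P.le_one hb hκ hκT hT t htT
      have hfB := hB t (Ioo_subset_Icc_self ht)
      set w := weight κ t
      set A := phase κ α t
      have hw0 : 0 < w := by linarith
      have e1 : 2 * κ / w * (A ^ 2 * f t ^ 2 - h t ^ 2) / w ^ 2 =
          κ * (2 / w ^ 3 * (A ^ 2 * f t ^ 2)) - κ * (2 / w ^ 2 * (h t ^ 2 / w)) := by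
        field_simp
      have e2 : (A ^ 2 / w - w / b * (1 - f t ^ 2)) * f t * f t + h t * (h t / w) + B * 1 =
          A ^ 2 / w * f t ^ 2 + h t ^ 2 / w + (B - w / b * (1 - f t ^ 2) * f t ^ 2) := by
        ring
      have h1 : w / b * (1 - f t ^ 2) ≤ 1 := by
        have h2 : w / b ≤ 1 := by rw [div_le_one (by linarith)]; linarith
        have h3 : 0 ≤ w / b := by positivity
        nlinarith [sq_nonneg (f t)]
      have h2 : 0 ≤ B - w / b * (1 - f t ^ 2) * f t ^ 2 := by
        nlinarith [mul_le_mul_of_nonneg_right h1 (sq_nonneg (f t))]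
      have h3 : 2 / w ^ 2 ≤ 8 := by
        rw [div_le_iff₀ (by positivity)]; nlinarith
      have h4 : 0 ≤ h t ^ 2 / w := by positivity
      have h5 : 2 / w ^ 2 * (h t ^ 2 / w) ≤ 8 * (h t ^ 2 / w) :=
        mul_le_mul_of_nonneg_right h3 h4
      have h6 : 0 ≤ κ * (2 / w ^ 3 * (A ^ 2 * f t ^ 2)) := by positivity
      have h7 : 0 ≤ κ * (A ^ 2 / w * f t ^ 2) := by positivity
      have h8 := mul_le_mul_of_nonneg_left h5 hκ
      have h9 := mul_nonneg hκ h2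
      rw [e1, e2]
      linarith
  have := hanti ⟨le_rfl, hs.2⟩ ⟨hs.2, le_rfl⟩ hs.2
  simp only [P.flux_end] at this
  linarith

/-- Lower bound on the cost function with the defect `d`, in terms of the boundary value of the
profile at the right end point. -/
lemma neg_le_cost (P : IsProfile b κ α T f h) (hb : 1 < b) (hκ : 0 < κ)
    (hκT : κ * T ≤ 1 / 2) (hT : 0 < T) {F : ℝ → ℝ} (hFc : ContinuousOn F (Icc 0 T))
    (hF' : ∀ t ∈ Ioo 0 T, HasDerivAt F (2 * (phase κ α t / weight κ t * f t ^ 2)) t)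
    (hF0 : F 0 = 0) (hFT : F T = 0) {M d : ℝ} (hM : 0 ≤ M) (hα : -M ≤ α) (hα1 : α ≤ 1)
    (hd : 0 ≤ d) (hd2 : d ≤ 1 / 2)
    (hsmall : d + 32 * (M + 1 + T) ^ 2 * d + 16 * κ * (M + 1 + T)
      + 8 * κ * harnackConst M ^ 2 * T ≤ 1 - 1 / b) :
    ∀ t ∈ Icc 0 T, -(4 * (M + 1 + T) ^ 2 * f T ^ 2) ≤ (1 - d) * f t ^ 2 + F t := by
  set S := M + 1 + T with hS
  set D := harnackConst M
  have hbound : 0 ≤ 4 * S ^ 2 * f T ^ 2 := by positivity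
  have hphase : ∀ t ∈ Icc 0 T, |phase κ α t| ≤ S := by
    intro t ht
    have h1 := phase_sub_mem (α := α) hκ.le hκT le_rfl ht.1 ht.2
    rw [phase_zero] at h1
    rw [abs_le]
    constructor <;> linarith [h1.1, h1.2, ht.1, ht.2]
  obtain ⟨m, hm, hmin⟩ := isCompact_Icc.exists_isMinOn (nonempty_Icc.2 hT.le)
    (f := fun t => (1 - d) * f t ^ 2 + F t) (by have := P.continuousOn; fun_prop)
  refine fun t ht => le_trans ?_ (hmin ht)
  rcases hm.1.eq_or_lt with h0 | h0
  · beta_reduce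
    rw [← h0, hF0]
    have : 0 ≤ (1 - d) * f 0 ^ 2 := mul_nonneg (by linarith) (sq_nonneg _)
    linarith
  rcases hm.2.eq_or_lt with h1 | h1
  · beta_reduce
    rw [h1, hFT]
    have : 0 ≤ (1 - d) * f T ^ 2 := mul_nonneg (by linarith) (sq_nonneg _)
    linarith
  have hmI : m ∈ Ioo 0 T := ⟨h0, h1⟩
  have hnhds := Icc_mem_nhds h0 h1
  obtain ⟨w1, w2⟩ := weight_mem hκ.le hκT hm
  have hw0 : 0 < weight κ m := by linarith
  -- The derivative of the cost carries an extra factor f(m). If f(m) = 0, then m also minimizes f,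
  -- so h(m) = 0 and the identity persists.
  have hcrit : (1 - d) * h m = -(phase κ α m * f m) := by
    have hloc := hmin.isLocalMin hnhds
    have h2 := hloc.hasDerivAt_eq_zero
      ((((P.hasDerivAt m hmI).pow 2).const_mul (1 - d)).add (hF' m hmI))
    have h3 : f m * ((1 - d) * h m + phase κ α m * f m) = 0 := by
      simp at h2
      field_simp at h2
      linarith
    rcases mul_eq_zero.1 h3 with h4 | h4
    · have hfl : IsMinOn f (Icc 0 T) m := fun s hs => by
        simp only [mem_ofPred_eq, h4]; exact P.nonneg s hs
      have h5 := (hfl.isLocalMin hnhds).hasDerivAt_eq_zero (P.hasDerivAt m hmI)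
      have h6 := (div_eq_zero_iff.1 h5).resolve_right hw0.ne'
      simp [h4, h6]
    · linarith
  have hf := P.nonneg m hm
  have hcomp := P.firstIntegral_le_of_primitive hb.le hκ.le hκT hT hFc hF' hm
    (B := (D * f m) ^ 2) fun s hs => by
      have h2 := P.le_harnackConst_mul hb.le hκ hκT hT hM hα hα1 hm.1 hs.1 hs.2
      have h3 := P.nonneg s ⟨hm.1.trans hs.1, hs.2⟩
      gcongr
  have hend : firstIntegral b κ α f h T ≤ 4 * S ^ 2 * f T ^ 2 := by
    have hTm : T ∈ Icc 0 T := ⟨hT.le, le_rfl⟩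
    have hf0 := P.nonneg T hTm
    have hf1 := P.le_one hb.le hκ.le hκT hT T hTm
    have hw := (weight_mem hκ.le hκT hTm).1
    have h2 := sq_div_sq_le hw (hphase T hTm)
    have h3 : 0 ≤ 1 / b * (f T ^ 2 - f T ^ 4 / 2) := by
      have : f T ^ 4 ≤ f T ^ 2 := pow_le_pow_of_le_one hf0 hf1 (by norm_num)
      have h4 : 0 ≤ f T ^ 2 - f T ^ 4 / 2 := by nlinarith [sq_nonneg (f T)]
      positivity
    have h4 := mul_le_mul_of_nonneg_right h2 (sq_nonneg (f T))
    simp only [firstIntegral, P.flux_end]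
    simp only [zero_div]
    linarith
  set A := phase κ α m with hA
  set w := weight κ m
  set y := f m
  obtain ⟨hquad, hcross⟩ := potential_sub_kinetic_ge w1 hd hd2 (hphase m hm) hcrit
  have hy2 : 0 ≤ y ^ 2 := sq_nonneg y
  have hg : (-(24 * S ^ 2 * d) - 1 / b) * y ^ 2 ≤ firstIntegral b κ α f h m := by
    have h3 : 0 ≤ 1 / b * (y ^ 4 / 2) := by positivity
    have h4 : firstIntegral b κ α f h m =
        -(h m / w) ^ 2 + A ^ 2 / w ^ 2 * y ^ 2 - 1 / b * (y ^ 2 - y ^ 4 / 2) := rfl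
    rw [h4]
    linarith
  have h2 : 8 * κ * (D * y) ^ 2 * (T - m) ≤ 8 * κ * D ^ 2 * T * y ^ 2 := by
    have h3 : 0 ≤ 8 * κ * (D * y) ^ 2 := by positivity
    have h4 := mul_le_mul_of_nonneg_left (show T - m ≤ T by linarith) h3
    linarith
  have h3 := mul_le_mul_of_nonneg_left hcross (show 0 ≤ 8 * κ by positivity)
  have h4 : 0 ≤ S ^ 2 * d := by positivity
  have h5 : 0 ≤ (1 - 1 / b - d - 32 * S ^ 2 * d - 16 * κ * S - 8 * κ * D ^ 2 * T) * y ^ 2 :=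
    mul_nonneg (by linarith) hy2
  have h6 : 0 ≤ S ^ 2 * d * y ^ 2 := by positivity
  rw [hFT] at hcomp
  linarith

end IsProfile

end Cost

/-! ### Case analysis on the phase and choice of the threshold -/

lemma continuousOn_phase_div_weight_mul {κ α T : ℝ} {f : ℝ → ℝ} (hf : ContinuousOn f (Icc 0 T))
    (hw : ∀ t ∈ Icc 0 T, 0 < weight κ t) :
    ContinuousOn (fun t => phase κ α t / weight κ t * f t ^ 2) (Icc 0 T) :=
  ((continuous_phase κ α).continuousOn.div (continuous_weight κ).continuousOn
    fun t ht => (hw t ht).ne').mul (hf.pow 2)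

lemma hasDerivAt_potentialF {k ε α T : ℝ} {f : ℝ → ℝ} (hf : ContinuousOn f (Icc 0 T))
    (hw : ∀ t ∈ Icc 0 T, 0 < weight (ε * k) t) {t : ℝ} (ht : t ∈ Ioo 0 T) :
    HasDerivAt (potentialF k ε α f)
      (2 * (phase (ε * k) α t / weight (ε * k) t * f t ^ 2)) t := by
  rw [show potentialF k ε α f = _ from funext (potentialF_eq k ε α f)]
  exact (hasDerivAt_integral_of_continuousOn (continuousOn_phase_div_weight_mul hf hw)
    ht).const_mul 2

lemma continuousOn_potentialF {k ε α T : ℝ} {f : ℝ → ℝ} (hT : 0 ≤ T)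
    (hf : ContinuousOn f (Icc 0 T)) (hw : ∀ t ∈ Icc 0 T, 0 < weight (ε * k) t) :
    ContinuousOn (potentialF k ε α f) (Icc 0 T) := by
  rw [show potentialF k ε α f = _ from funext (potentialF_eq k ε α f)]
  have hi : IntervalIntegrable
      (fun t => phase (ε * k) α t / weight (ε * k) t * f t ^ 2) volume 0 T := by
    apply ContinuousOn.intervalIntegrable
    rw [uIcc_of_le hT]
    exact continuousOn_phase_div_weight_mul hf hw
  have := (hi.absolutelyContinuousOnInterval_intervalIntegral (c := 0) (by simp)).continuousOn
  rw [uIcc_of_le hT] at this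
  exact continuousOn_const.mul this

lemma costK_eq_zero {k ε d α T : ℝ} {f : ℝ → ℝ} (hf : ∀ t ∈ Icc 0 T, f t = 0) {t : ℝ}
    (ht : t ∈ Icc 0 T) : costK k ε d α f t = 0 := by
  have h1 : ∫ η in (0 : ℝ)..t, phase (ε * k) α η / weight (ε * k) η * f η ^ 2 =
      ∫ _ in (0 : ℝ)..t, (0 : ℝ) := by
    apply intervalIntegral.integral_congr
    intro η hη
    rw [uIcc_of_le ht.1] at hη
    simp [hf η ⟨hη.1, hη.2.trans ht.2⟩]
  simp [costK, potentialF_eq, h1, hf t ht]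

/-- Non-negativity of the cost function under explicit smallness conditions, `l` standing for
`|log ε|` and `M` for the threshold between small and large phases. -/
lemma costK_nonneg_of_small {b k c₀ ε α d e l : ℝ} {f : ℝ → ℝ} (hb : 1 < b) (hk : 0 < k)
    (hε : 0 < ε) (hT : 0 < tEps c₀ ε) (hκT : ε * k * tEps c₀ ε ≤ 1 / 2)
    (hκδ : 8 * (ε * k * tEps c₀ ε) ≤ 1 - 1 / b) (hf : IsOptimal b k c₀ ε α f)
    {M : ℝ} (hM : M = 1024 / (1 - 1 / b)) (hl : 0 ≤ l) (hlD : harnackConst M < l ^ 3)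
    (hd : 0 ≤ d) (he : 0 ≤ e) (hde : d + e ≤ 1 / 2)
    (hsmall : (d + e) + 32 * (M + 1 + tEps c₀ ε) ^ 2 * (d + e)
      + 16 * (ε * k) * (M + 1 + tEps c₀ ε)
      + 8 * (ε * k) * harnackConst M ^ 2 * tEps c₀ ε ≤ 1 - 1 / b)
    (hel : 4 * (M + 1 + tEps c₀ ε) ^ 2 ≤ e * l ^ 6) {t : ℝ} (ht : t ∈ Icc 0 (tEps c₀ ε))
    (hreg : l ^ 3 * f (tEps c₀ ε) ≤ f t) : 0 ≤ costK k ε d α f t := by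
  set T := tEps c₀ ε with hTdef
  have hκ : 0 < ε * k := mul_pos hε hk
  have hw : ∀ t ∈ Icc 0 T, 0 < weight (ε * k) t := fun t ht => by
    linarith [(weight_mem hκ.le hκT ht).1]
  have hw1 : ∀ t ∈ Icc 0 T, weight (ε * k) t ≤ 1 := fun t ht => (weight_mem hκ.le hκT ht).2
  obtain ⟨h, P⟩ := hf.exists_isProfile hT hw
  have hM0 : 0 ≤ M := by
    have : 1 / b < 1 := by rw [div_lt_one (by linarith)]; exact hb
    have : 0 < 1 - 1 / b := by linarith
    rw [hM]; positivity
  have hfT := P.nonneg T ⟨hT.le, le_rfl⟩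
  rcases le_total 1 α with hα1 | hα1
  · refine (costK_eq_zero (P.eq_zero_of_one_le_phase hb hκ.le hκT hT fun s hs => ?_) ht).ge
    have := (phase_sub_mem (α := α) hκ.le hκT le_rfl hs.1.le hs.2.le).1
    rw [phase_zero] at this
    have : 1 ≤ phase (ε * k) α s := by linarith [hs.1]
    nlinarith
  rcases le_total (phase (ε * k) α T) M with hAM | hAM
  · have hH := P.le_harnackConst_mul_end hb.le hκ hκT hT hM0 hAM
    have hfT0 : f T = 0 := by
      have := hH t ht
      nlinarith
    refine (costK_eq_zero (fun s hs => ?_) ht).ge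
    have h1 := hH s hs
    rw [hfT0, mul_zero] at h1
    exact le_antisymm h1 (P.nonneg s hs)
  rcases le_total α (-M) with hαM | hαM
  · exact (costK_eq_zero (P.eq_zero_of_phase_large hb hκ.le hκT hT hκδ (hM ▸ hαM)
      (hM ▸ hAM)) ht).ge
  -- The bound is applied with defect d + e; the difference e f(t)² ≥ e l⁶ f(T)² then covers the
  -- boundary term.
  have hlow := P.neg_le_cost hb hκ hκT hT (continuousOn_potentialF hT.le P.continuousOn hw)
    (fun s hs => hasDerivAt_potentialF P.continuousOn hw hs) (by simp [potentialF])
    (hf.potentialF_end (by linarith) hT.le hw hw1) hM0 hαM hα1 (by linarith) hde hsmall t ht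
  have hsq : (l ^ 3 * f T) ^ 2 ≤ f t ^ 2 := by gcongr
  have h1 := mul_le_mul_of_nonneg_left hsq he
  have h2 := mul_le_mul_of_nonneg_right hel (sq_nonneg (f T))
  have h3 : e * (l ^ 3 * f T) ^ 2 = e * l ^ 6 * f T ^ 2 := by ring
  unfold costK
  linarith

/-- For `l` large, the smallness conditions on the curvature parameter `κ` and on the defects `d`
and `l⁻³` are met, on an interval of length `c₀ l`. -/
lemma exists_threshold {k c₀ C δ M D : ℝ} (hk : 0 < k) (hc₀ : 0 < c₀) (hC : 0 < C) (hδ : 0 < δ)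
    (hM : 0 ≤ M) (hD : 0 ≤ D) : ∃ L : ℝ, 0 < L ∧ ∀ l, L < l → ∀ κ, 0 < κ → κ * l ^ 2 ≤ 2 * k →
      ∀ d, 0 < d → d * l ^ 4 ≤ C →
      κ * (c₀ * l) ≤ 1 / 2 ∧ 8 * (κ * (c₀ * l)) ≤ δ ∧ D < l ^ 3 ∧ d + 1 / l ^ 3 ≤ 1 / 2 ∧
      (d + 1 / l ^ 3) + 32 * (M + 1 + c₀ * l) ^ 2 * (d + 1 / l ^ 3)
        + 16 * κ * (M + 1 + c₀ * l) + 8 * κ * D ^ 2 * (c₀ * l) ≤ δ ∧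
      4 * (M + 1 + c₀ * l) ^ 2 ≤ 1 / l ^ 3 * l ^ 6 := by
  set σ := M + 1 + c₀ with hσ
  have hσ0 : 0 < σ := by positivity
  set Z := (C + 1) + 32 * σ ^ 2 * (C + 1) + 16 * σ * (2 * k) + 8 * D ^ 2 * c₀ * (2 * k) with hZ
  have hZ0 : 0 < Z := by positivity
  refine ⟨1 + D + 2 * (C + 1) + 4 * σ ^ 2 + 4 * k * c₀ + 16 * k * c₀ / δ + Z / δ,
    by positivity, fun l hl κ hκ hκl d hd hdl => ?_⟩
  have p1 : 0 < σ ^ 2 := by positivity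
  have p2 : 0 < k * c₀ := by positivity
  have p3 : 0 < 16 * k * c₀ / δ := by positivity
  have p4 : 0 < Z / δ := by positivity
  have hl1 : 1 < l := by linarith
  have hlD : D < l := by linarith
  have hlC : 2 * (C + 1) < l := by linarith
  have hlσ : 4 * σ ^ 2 < l := by linarith
  have hlk : 4 * k * c₀ < l := by linarith
  have hlδ : 16 * k * c₀ < δ * l := by
    have : 16 * k * c₀ / δ < l := by linarith
    rwa [div_lt_iff₀ hδ, mul_comm l] at this
  have hlZ : Z < δ * l := by
    have : Z / δ < l := by linarith
    rwa [div_lt_iff₀ hδ, mul_comm l] at this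
  have hl0 : 0 < l := by linarith
  have hl3 : l ≤ l ^ 3 := le_self_pow₀ hl1.le (by norm_num)
  have hS : M + 1 + c₀ * l ≤ σ * l := by
    have := mul_le_mul_of_nonneg_left hl1.le (show 0 ≤ M + 1 by positivity)
    linarith
  have hS0 : 0 ≤ M + 1 + c₀ * l := by positivity
  have hS2 : (M + 1 + c₀ * l) ^ 2 ≤ σ ^ 2 * l ^ 2 := by
    rw [← mul_pow]; gcongr
  -- The extra defect l⁻³ lies strictly between two scales: small against l⁻², so that S² l⁻³ is
  -- small for S = M + 1 + c₀ l, and large against l⁻⁴, so that l⁻³ l⁶ exceeds 4 S².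
  set e := d + 1 / l ^ 3 with he
  have he0 : 0 < e := by positivity
  have hel3 : e * l ^ 3 ≤ C + 1 := by
    have h1 : e * l ^ 3 = d * l ^ 3 + 1 := by rw [he]; field_simp
    have h2 : d * l ^ 3 ≤ d * l ^ 4 := by
      have : l ^ 3 ≤ l ^ 4 := pow_le_pow_right₀ hl1.le (by norm_num)
      gcongr
    linarith
  have hel : e * l ≤ C + 1 := (mul_le_mul_of_nonneg_left hl3 he0.le).trans hel3
  refine ⟨?_, ?_, ?_, ?_, ?_, ?_⟩
  · refine le_of_mul_le_mul_right (a := l) ?_ hl0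
    have := mul_le_mul_of_nonneg_right hκl hc₀.le
    linarith
  · refine le_of_mul_le_mul_right (a := l) ?_ hl0
    have := mul_le_mul_of_nonneg_right hκl hc₀.le
    linarith
  · linarith
  · refine le_of_mul_le_mul_right (a := l) ?_ hl0
    linarith
  · refine le_of_mul_le_mul_right (a := l) ?_ hl0
    have t1 : 32 * (M + 1 + c₀ * l) ^ 2 * e * l ≤ 32 * σ ^ 2 * (C + 1) := by
      have h1 : 32 * (M + 1 + c₀ * l) ^ 2 * (e * l) ≤ 32 * (σ ^ 2 * l ^ 2) * (e * l) := by gcongr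
      have h2 := mul_le_mul_of_nonneg_left hel3 (show 0 ≤ 32 * σ ^ 2 by positivity)
      linarith
    have t2 : 16 * κ * (M + 1 + c₀ * l) * l ≤ 16 * σ * (2 * k) := by
      have h1 : 16 * κ * l * (M + 1 + c₀ * l) ≤ 16 * κ * l * (σ * l) := by gcongr
      have h2 := mul_le_mul_of_nonneg_left hκl (show 0 ≤ 16 * σ by positivity)
      linarith
    have t3 : 8 * κ * D ^ 2 * (c₀ * l) * l ≤ 8 * D ^ 2 * c₀ * (2 * k) := by
      have h2 := mul_le_mul_of_nonneg_left hκl (show 0 ≤ 8 * D ^ 2 * c₀ by positivity)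
      linarith
    linarith
  · have h1 : 1 / l ^ 3 * l ^ 6 = l * l ^ 2 := by field_simp
    rw [h1]
    have h2 := mul_le_mul_of_nonneg_right hlσ.le (sq_nonneg l)
    linarith

end SurfaceSC

end

theorem proposition3p2 (b k c₀ C : ℝ) (hb : 1 < b) (hbΘ : b < SurfaceSC.Theta0⁻¹)
    (hk : 0 < k) (hc₀ : 0 < c₀) (hC : 0 < C) :
    ∃ ε₀ : ℝ, 0 < ε₀ ∧ ∀ ε : ℝ, 0 < ε → ε < ε₀ →
      ∀ d : ℝ, 0 < d → d ≤ C * |Real.log ε| ^ (-4 : ℤ) →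
      ∀ (α : ℝ) (f : ℝ → ℝ), SurfaceSC.IsOptimal b k c₀ ε α f →
      ∀ t ∈ SurfaceSC.region c₀ ε f, 0 ≤ SurfaceSC.costK k ε d α f t := by
  have hδ : 0 < 1 - 1 / b := by
    have : 1 / b < 1 := by rw [div_lt_one (by linarith)]; exact hb
    linarith
  have hM : 0 ≤ 1024 / (1 - 1 / b) := by positivity
  obtain ⟨L, hL, hsmall⟩ := SurfaceSC.exists_threshold hk hc₀ hC hδ hM
    (zero_le_one.trans (SurfaceSC.one_le_harnackConst hM))
  refine ⟨Real.exp (-L), Real.exp_pos _, fun ε hε hεL d hd hdC α f hf t ht => ?_⟩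
  have hlog : Real.log ε < -L := (Real.log_lt_iff_lt_exp hε).2 hεL
  set l := |Real.log ε| with hl
  have hlε : l = -Real.log ε := abs_of_neg (by linarith)
  have hLl : L < l := by linarith
  have hl0 : 0 < l := by linarith
  -- From exp(l) ≥ l²/2 and ε = exp(-l): the curvature is at most of order l⁻², which is all that
  -- the threshold requires.
  have hεl : ε * l ^ 2 ≤ 2 := by
    have h1 : l ^ 2 / 2 ≤ Real.exp l := by
      have := Real.quadratic_le_exp_of_nonneg hl0.le
      linarith
    have h2 : ε * Real.exp l = 1 := by
      rw [hlε, Real.exp_neg, Real.exp_log hε, mul_inv_cancel₀ hε.ne']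
    have h3 := mul_le_mul_of_nonneg_left h1 hε.le
    linarith
  have hdl : d * l ^ 4 ≤ C := by
    have h1 : l ^ (-4 : ℤ) = (l ^ 4)⁻¹ := by rw [zpow_neg]; norm_cast
    rwa [h1, ← div_eq_mul_inv, le_div_iff₀ (by positivity)] at hdC
  obtain ⟨h1, h2, h3, h4, h5, h6⟩ := hsmall l hLl (ε * k) (mul_pos hε hk)
    (by have := mul_le_mul_of_nonneg_right hεl hk.le; linarith) d hd hdl
  exact SurfaceSC.costK_nonneg_of_small hb hk hε (mul_pos hc₀ hl0) h1 h2 hf rfl hl0.le h3 hd.le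
    (by positivity) h4 h5 h6 ht.1 ht.2
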